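/- Let $\Gamma$ be a finite subgroup of $\mathbf{SL}_3\mathbb{C}$ and let $\gamma_0,\dots,\gamma_l$ be representatives of the equivalence classes of irreducible finite-dimensional complex representations of $\Gamma$, where $\gamma_0$ is the trivial representation. Let $\gamma$ be the natural $3$-dimensional representation of $\Gamma$ and $\gamma^*$ its contragredient. Define $(l+1)\times(l+1)$ matrices $A^{(1)}=(a^{(1)}_{ij})$ and $A^{(2)}=(a^{(2)}_{ij})$ of nonnegative integers by $$\gamma_j\otimes\gamma=\bigoplus_{i=0}^l a^{(1)}_{ij}\gamma_i,\qquad \gamma_j\otimes\gamma^*=\bigoplus_{i=0}^l a^{(2)}_{ij}\gamma_i .$$ For $(m,n)\in\mathbb{N}^2$ let $\pi_{m,n}$ be the irreducible representation of $\mathbf{SL}_3\mathbb{C}$ of highest weight $m\varpi_1+n\varpi_2$, where $\varpi_1,\varpi_2$ are the fundamental weights, numbered so that $\pi_{1,0}$ is the natural representation of $\mathbf{SL}_3\mathbb{C}$ and $\pi_{0,1}$ its dual. Concretely, $\pi_{m,n}$ is the subrepresentation of $\mathrm{Sym}^m(\mathbb{C}^3)\otimes \mathrm{Sym}^n((\mathbb{C}^3)^*)$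 generated by $e_1^m\otimes (e_3^*)^n$; it is finite-dimensional and irreducible, of highest weight $m\varpi_1+n\varpi_2$. Let $m_i(m,n)$ be the multiplicity of $\gamma_i$ in the restriction of $\pi_{m,n}$ to $\Gamma$, let $v_{m,n}=(m_0(m,n),\dots,m_l(m,n))\in\mathbb{C}^{l+1}$, and let $$P_\Gamma(t,u)=\sum_{m=0}^\infty\sum_{n=0}^\infty v_{m,n}\,t^m u^n\in(\mathbb{C}[\![t,u]\!])^{l+1}.$$ Then $v_{0,0}=(1,0,\dots,0)$, and $$\left(1-tA^{(1)}+t^2A^{(2)}-t^3\right)\left(1-uA^{(2)}+u^2A^{(1)}-u^3\right)P_\Gamma(t,u)=(1-tu)\,v_{0,0}.$$ -/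

import Mathlib

open scoped Matrix

/-- The group `SL₃(ℂ)`. -/
abbrev SL3 : Type := Matrix.SpecialLinearGroup (Fin 3) ℂ

/-- The natural representation of `SL₃(ℂ)` on `ℂ³`. -/
noncomputable def natRep : Representation ℂ SL3 (Fin 3 → ℂ) where
  toFun g := Matrix.toLin' (g : Matrix (Fin 3) (Fin 3) ℂ)
  map_one' := by
    rw [Matrix.SpecialLinearGroup.coe_one, Matrix.toLin'_one]
    rfl
  map_mul' g h := by
    rw [Matrix.SpecialLinearGroup.coe_mul, Matrix.toLin'_mul]
    rfl

/-- The symmetric algebra of `ℂ³ ⊕ (ℂ³)*`, that is `Sym(ℂ³) ⊗ Sym((ℂ³)*)`, as a polynomial ring: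
`X (Sum.inl i)` is the standard basis vector `eᵢ` of `ℂ³` and `X (Sum.inr i)` is the dual basis
vector `eᵢ*`. -/
abbrev SymPair : Type := MvPolynomial (Fin 3 ⊕ Fin 3) ℂ

/-- The algebra endomorphism by which `g` acts on `SymPair`: `g eᵢ = ∑ⱼ gⱼᵢ eⱼ` and (the
contragredient action) `g eᵢ* = eᵢ* ∘ g⁻¹ = ∑ⱼ (g⁻¹)ᵢⱼ eⱼ*`. -/
noncomputable def symPairAct (g : SL3) : SymPair →ₐ[ℂ] SymPair :=
  MvPolynomial.aeval (Sum.elim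
    (fun i => ∑ j, MvPolynomial.C (g j i) * MvPolynomial.X (Sum.inl j))
    (fun i => ∑ j, MvPolynomial.C (g⁻¹ i j) * MvPolynomial.X (Sum.inr j)))

theorem symPairAct_X_inl (g : SL3) (i : Fin 3) :
    symPairAct g (MvPolynomial.X (Sum.inl i)) =
      ∑ j, MvPolynomial.C (g j i) * MvPolynomial.X (Sum.inl j) := by
  simp [symPairAct]

theorem symPairAct_X_inr (g : SL3) (i : Fin 3) :
    symPairAct g (MvPolynomial.X (Sum.inr i)) =
      ∑ j, MvPolynomial.C (g⁻¹ i j) * MvPolynomial.X (Sum.inr j) := by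
  simp only [symPairAct, MvPolynomial.aeval_X, Sum.elim_inr]

theorem symPairAct_one : symPairAct 1 = AlgHom.id ℂ SymPair := by
  apply MvPolynomial.algHom_ext
  rintro (i | i)
  · rw [symPairAct_X_inl, Fin.sum_univ_three]
    fin_cases i <;> simp
  · rw [symPairAct_X_inr, Fin.sum_univ_three, inv_one]
    fin_cases i <;> simp

theorem symPairAct_mul (g h : SL3) :
    symPairAct (g * h) = (symPairAct g).comp (symPairAct h) := by
  apply MvPolynomial.algHom_ext
  rintro (i | i)
  · simp only [AlgHom.comp_apply, symPairAct_X_inl, map_mul, MvPolynomial.algHom_C,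
      MvPolynomial.algebraMap_eq, Matrix.SpecialLinearGroup.coe_mul, Matrix.mul_apply,
      Fin.sum_univ_three, map_add]
    ring
  · simp only [AlgHom.comp_apply, symPairAct_X_inr, map_mul, MvPolynomial.algHom_C,
      MvPolynomial.algebraMap_eq, mul_inv_rev, Matrix.SpecialLinearGroup.coe_mul, Matrix.mul_apply,
      Fin.sum_univ_three, map_add]
    ring

/-- The representation of `SL₃(ℂ)` on `Sym(ℂ³) ⊗ Sym((ℂ³)*)`. -/
noncomputable def symPairRep : Representation ℂ SL3 SymPair where
  toFun g := (symPairAct g).toLinearMap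
  map_one' := by
    rw [symPairAct_one]
    rfl
  map_mul' g h := by
    rw [symPairAct_mul]
    rfl

/-- The vector `e₀ᵐ (e₂*)ⁿ` of `Symᵐ(ℂ³) ⊗ Symⁿ((ℂ³)*)`, of weight `m ϖ₁ + n ϖ₂`. -/
noncomputable def highestWeightVector (m n : ℕ) : SymPair :=
  MvPolynomial.X (Sum.inl 0) ^ m * MvPolynomial.X (Sum.inr 2) ^ n

/-- The subrepresentation `V(m ϖ₁ + n ϖ₂)` of `Symᵐ(ℂ³) ⊗ Symⁿ((ℂ³)*)` generated by the vector
`e₀ᵐ (e₂*)ⁿ`: the Cartan product construction of the simple module of highest weight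
`m ϖ₁ + n ϖ₂`. -/
noncomputable def highestWeightSub (m n : ℕ) : Subrepresentation symPairRep where
  toSubmodule := Submodule.span ℂ (Set.range fun g => symPairRep g (highestWeightVector m n))
  apply_mem_toSubmodule g v hv := by
    induction hv using Submodule.span_induction with
    | mem x hx =>
      obtain ⟨h, rfl⟩ := hx
      refine Submodule.subset_span ⟨g * h, ?_⟩
      simp [map_mul]
    | zero => simp
    | add x y _ _ hx hy =>
      rw [map_add]
      exact Submodule.add_mem _ hx hy
    | smul a x _ hx =>
      rw [map_smul]
      exact Submodule.smul_mem _ a hx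

/-- The representation `π_{m,n}` of `SL₃(ℂ)` on `V(m ϖ₁ + n ϖ₂)`. -/
noncomputable def piRep (m n : ℕ) :
    Representation ℂ SL3 (highestWeightSub m n).toSubmodule :=
  (highestWeightSub m n).toRepresentation

/-- `ρ` is a finite-dimensional irreducible representation of `SL₃(ℂ)` of highest weight
`m ϖ₁ + n ϖ₂`: there is a nonzero vector on which the upper triangular matrices `b` act through
the character `m ϖ₁ + n ϖ₂`, where `ϖ₁(b) = b₀₀` and `ϖ₂(b) = b₀₀ b₁₁`. -/
def IsSimpleOfHighestWeight {V : Type*} [AddCommGroup V] [Module ℂ V] (m n : ℕ)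
    (ρ : Representation ℂ SL3 V) : Prop :=
  FiniteDimensional ℂ V ∧ ρ.IsIrreducible ∧
    ∃ v : V, v ≠ 0 ∧ ∀ b : SL3, (b : Matrix (Fin 3) (Fin 3) ℂ).BlockTriangular id →
      ρ b v = (b 0 0 ^ m * (b 0 0 * b 1 1) ^ n) • v

/-- The family `γ₀, …, γ_l` is a complete system of representatives of the equivalence classes of
irreducible finite-dimensional complex representations of `G`, with `γ₀` the trivial one. -/
structure IsIrrepSystem {G : Type*} [Group G] {l : ℕ} {W : Fin (l + 1) → Type*}
    [∀ i, AddCommGroup (W i)] [∀ i, Module ℂ (W i)]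
    (γ : ∀ i, Representation ℂ G (W i)) : Prop where
  finiteDimensional : ∀ i, FiniteDimensional ℂ (W i)
  irreducible : ∀ i, (γ i).IsIrreducible
  not_equiv : ∀ i j, i ≠ j → IsEmpty ((γ i).Equiv (γ j))
  complete : ∀ (U : Type) [AddCommGroup U] [Module ℂ U] [FiniteDimensional ℂ U]
    (τ : Representation ℂ G U), τ.IsIrreducible → ∃ i, Nonempty (τ.Equiv (γ i))
  zero_trivial : Nonempty ((γ 0).Equiv (Representation.trivial ℂ G ℂ))

/-- The multiplicity of an irreducible complex representation `σ` in a finite-dimensional completely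
reducible representation `ρ`: the dimension of `Hom_G(σ, ρ)`. -/
noncomputable def repMultiplicity {G V W : Type*} [Group G] [AddCommGroup V] [Module ℂ V]
    [AddCommGroup W] [Module ℂ W] (σ : Representation ℂ G V) (ρ : Representation ℂ G W) : ℕ :=
  Module.finrank ℂ (Representation.IntertwiningMap σ ρ)

section McKay

variable {Γ : Subgroup SL3} {l : ℕ} {W : Fin (l + 1) → Type*}
  [∀ i, AddCommGroup (W i)] [∀ i, Module ℂ (W i)]

/-- The natural three-dimensional representation of `Γ`. -/
noncomputable def natRepOf (Γ : Subgroup SL3) : Representation ℂ Γ (Fin 3 → ℂ) :=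
  natRep.comp Γ.subtype

/-- The matrix `A⁽¹⁾`: its `(i, j)` entry is the multiplicity of `γᵢ` in `γⱼ ⊗ (natural)`. -/
noncomputable def mckayOne (γ : ∀ i, Representation ℂ Γ (W i)) :
    Matrix (Fin (l + 1)) (Fin (l + 1)) ℕ :=
  Matrix.of fun i j => repMultiplicity (γ i) ((γ j).tprod (natRepOf Γ))

/-- The matrix `A⁽²⁾`: its `(i, j)` entry is the multiplicity of `γᵢ` in `γⱼ ⊗ (natural)*`. -/
noncomputable def mckayTwo (γ : ∀ i, Representation ℂ Γ (W i)) :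
    Matrix (Fin (l + 1)) (Fin (l + 1)) ℕ :=
  Matrix.of fun i j => repMultiplicity (γ i) ((γ j).tprod (natRepOf Γ).dual)

/-- The vector `v_{m,n}` of the multiplicities of the `γᵢ` in `π_{m,n}` restricted to `Γ`. -/
noncomputable def multVec (γ : ∀ i, Representation ℂ Γ (W i)) (m n : ℕ) : Fin (l + 1) → ℂ :=
  fun i => (repMultiplicity (γ i) ((piRep m n).comp Γ.subtype) : ℂ)

/-- The vector `P_Γ(t, u) = ∑ v_{m,n} tᵐ uⁿ` of formal power series, where `t` is the variable `X 0`
and `u` is the variable `X 1`. -/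
noncomputable def genSeries (γ : ∀ i, Representation ℂ Γ (W i)) :
    Fin (l + 1) → MvPowerSeries (Fin 2) ℂ :=
  fun i => fun d : Fin 2 →₀ ℕ => multVec γ (d 0) (d 1) i

/-- A matrix of natural numbers, viewed over the ring `ℂ⟦t, u⟧`. -/
noncomputable def seriesMatrix (A : Matrix (Fin (l + 1)) (Fin (l + 1)) ℕ) :
    Matrix (Fin (l + 1)) (Fin (l + 1)) (MvPowerSeries (Fin 2) ℂ) :=
  A.map fun a => (a : MvPowerSeries (Fin 2) ℂ)

end McKay

/-!
The simple module `V(m ϖ₁ + n ϖ₂)` sits in the polynomial ring `Sym(ℂ³) ⊗ Sym((ℂ³)*)`, and the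
proof describes it there as the orthogonal complement of the multiples of the contraction
`q = ∑ eᵢ eᵢ*`.

*The simple modules.* On each bigraded piece `S_{m,n} = Symᵐ(ℂ³) ⊗ Symⁿ((ℂ³)*)` there is the
positive definite Hermitian form `⟨p, r⟩ = ∑ d! (conj p_d) r_d`, for which the products
`(∑ aᵢ eᵢ)ᵐ (∑ bᵢ eᵢ*)ⁿ` represent the evaluations of polynomials, up to a factor and complex
conjugation (`inner_linearPowers`). The translates of `e₀ᵐ (e₂*)ⁿ` are the products with
`a, b ≠ 0` and `∑ aᵢ bᵢ = 0` (`exists_SL3_of_mem_cone`), so the orthogonal complement of their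
span `V` consists of the polynomials that vanish on the cone `q = 0`, and these are the multiples
of `q` (`contraction_dvd_of_vanishesOnCone`). Hence `S_{m,n} = V ⊕ q S_{m-1,n-1}`
(`isCompl_highestPart_contractionPart`). Irreducibility follows as well: a nonzero vector of `V` is
not orthogonal to all translates of the highest weight vector, so one of its own translates
has a nonzero coefficient at the monomial `e₀ᵐ (e₂*)ⁿ`, and a polynomial in the torus element
`diag(2, 1, 1/2)` isolates this monomial (`highestWeightVector_mem_of_coeff_ne_zero`).

*The characters.* An element `g` of finite order is diagonalizable, its trace on `S_{m,n}` is the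
sum of the monomials of bidegree `(m, n)` in its eigenvalues and their inverses, and the
generating series of these traces is a product of geometric series. With the
decomposition above this gives
`∑ χ_{m,n}(g) tᵐ uⁿ = (1 - t u) / (det(1 - t g) det(1 - u g⁻¹))`
(`charpoly_mul_characterSeries`).

*The McKay matrices.* By the orthogonality relations and Maschke's theorem, the vector
`w_g = (χ_i(g⁻¹))ᵢ` is an eigenvector of `A⁽¹⁾` with eigenvalue `tr g` and of `A⁽²⁾` with eigenvalue
`tr g⁻¹` (`IsIrrepSystem.sum_repMultiplicity_tprod_mul_character`). The two matrix polynomials thus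
act on `w_g` as `det(1 - t g)` and `det(1 - u g⁻¹)`. As `P_Γ` is the average over `g ∈ Γ` of
`(∑ χ_{m,n}(g) tᵐ uⁿ) w_g`, their product sends it to `(1 - t u)` times the average of the `w_g`,
which is `v_{0,0}`.
-/

/-! ### Characters of a finite group -/

/-- The character of a representation is the sum of its characters on two complementary
subrepresentations. -/
theorem Representation.character_eq_add_of_isCompl {k G V : Type*} [Field k] [Group G]
    [AddCommGroup V] [Module k V] [FiniteDimensional k V] (ρ : Representation k G V)
    (p q : Subrepresentation ρ) (h : IsCompl p.toSubmodule q.toSubmodule) (g : G) :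
    ρ.character g = p.toRepresentation.character g + q.toRepresentation.character g := by
  have e := LinearMap.trace_conj' ((p.toRepresentation g).prodMap (q.toRepresentation g))
    (Submodule.prodEquivOfIsCompl _ _ h)
  rw [LinearMap.trace_prodMap'] at e
  rw [Representation.character, Representation.character, Representation.character, ← e]
  congr 1
  ext v
  obtain ⟨⟨x, y⟩, rfl⟩ := (Submodule.prodEquivOfIsCompl _ _ h).surjective v
  rw [LinearEquiv.conj_apply_apply, LinearEquiv.symm_apply_apply]
  simp [Subrepresentation.toRepresentation]

/-- The multiplicity as a scalar product of characters. -/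
theorem repMultiplicity_eq_sum {G V W : Type*} [Group G] [Fintype G] [AddCommGroup V] [Module ℂ V]
    [FiniteDimensional ℂ V] [AddCommGroup W] [Module ℂ W] [FiniteDimensional ℂ W]
    (σ : Representation ℂ G V) (ρ : Representation ℂ G W) :
    (repMultiplicity σ ρ : ℂ) =
      (Nat.card G : ℂ)⁻¹ * ∑ g, ρ.character g * σ.character g⁻¹ := by
  have : Invertible (Nat.card G : ℂ) :=
    invertibleOfNonzero (Nat.cast_ne_zero.mpr Nat.card_pos.ne')
  rw [repMultiplicity, Representation.card_inv_mul_sum_char_mul_char_eq_finrank]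

theorem repMultiplicity_of_character_eq_add {G V W W₁ W₂ : Type*} [Group G] [Finite G]
    [AddCommGroup V] [Module ℂ V] [FiniteDimensional ℂ V] [AddCommGroup W] [Module ℂ W]
    [FiniteDimensional ℂ W] [AddCommGroup W₁] [Module ℂ W₁] [FiniteDimensional ℂ W₁]
    [AddCommGroup W₂] [Module ℂ W₂] [FiniteDimensional ℂ W₂]
    (σ : Representation ℂ G V) (ρ : Representation ℂ G W) (ρ₁ : Representation ℂ G W₁)
    (ρ₂ : Representation ℂ G W₂) (h : ∀ g, ρ.character g = ρ₁.character g + ρ₂.character g) :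
    (repMultiplicity σ ρ : ℂ) = repMultiplicity σ ρ₁ + repMultiplicity σ ρ₂ := by
  have := Fintype.ofFinite G
  simp only [repMultiplicity_eq_sum, h, add_mul, Finset.sum_add_distrib, mul_add]

section IrrepSystem

variable {G : Type*} [Group G] {l : ℕ} {W : Fin (l + 1) → Type*}
    [∀ i, AddCommGroup (W i)] [∀ i, Module ℂ (W i)] {γ : ∀ i, Representation ℂ G (W i)}

theorem IsIrrepSystem.repMultiplicity_eq [Finite G] (hγ : IsIrrepSystem γ) (i j : Fin (l + 1)) :
    (repMultiplicity (γ i) (γ j) : ℂ) = if i = j then 1 else 0 := by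
  classical
  have := hγ.finiteDimensional
  have := hγ.irreducible
  have := Fintype.ofFinite G
  have : Invertible (Nat.card G : ℂ) :=
    invertibleOfNonzero (Nat.cast_ne_zero.mpr Nat.card_pos.ne')
  rw [repMultiplicity_eq_sum, Representation.char_orthonormal]
  by_cases h : i = j
  · subst h
    rw [if_pos ⟨Representation.Equiv.refl _⟩, if_pos rfl]
  · rw [if_neg h, if_neg (not_nonempty_iff.mpr (hγ.not_equiv i j h))]

/-- The decomposition of a character of a representation on a space in `Type`, to which
`IsIrrepSystem.complete` applies, by induction on the dimension: a reducible representation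
splits by Maschke's theorem. -/
theorem IsIrrepSystem.character_eq_sum_of_type_zero [Finite G] (hγ : IsIrrepSystem γ) (n : ℕ) :
    ∀ (V : Type) [AddCommGroup V] [Module ℂ V] [FiniteDimensional ℂ V]
      (ρ : Representation ℂ G V), Module.finrank ℂ V ≤ n → ∀ g,
      ρ.character g = ∑ j, (repMultiplicity (γ j) ρ : ℂ) * (γ j).character g := by
  have := hγ.finiteDimensional
  have := Fintype.ofFinite G
  have hne : NeZero (Nat.card G : ℂ) := ⟨Nat.cast_ne_zero.mpr Nat.card_pos.ne'⟩
  induction n with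
  | zero =>
    intro V _ _ _ ρ hn g
    have hV := Module.finrank_zero_iff.mp (Nat.le_zero.mp hn)
    have h0 : ∀ g, ρ.character g = 0 := fun g => by
      rw [Representation.character, Subsingleton.elim (ρ g) 0, map_zero]
    simp only [repMultiplicity_eq_sum, h0, zero_mul, Finset.sum_const_zero, mul_zero]
  | succ n ih =>
    intro V _ _ _ ρ hn g
    by_cases hρ : ρ.IsIrreducible
    · obtain ⟨i, ⟨φ⟩⟩ := hγ.complete V ρ hρ
      have h1 := Representation.char_iso φ
      have h2 : ∀ j, (repMultiplicity (γ j) ρ : ℂ) = if j = i then 1 else 0 := fun j => by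
        rw [repMultiplicity_eq_sum, h1, ← repMultiplicity_eq_sum, hγ.repMultiplicity_eq]
      simp [h1, h2]
    · by_cases hV : Subsingleton V
      · exact ih V ρ (by rw [Module.finrank_zero_of_subsingleton]; omega) g
      obtain ⟨p, hp⟩ : ∃ p : Subrepresentation ρ, ¬ (p = ⊥ ∨ p = ⊤) := by
        by_contra! hcon
        have : Nontrivial (Subrepresentation ρ) := by
          refine ⟨⊥, ⊤, fun h => hV ?_⟩
          have h' : (⊥ : Submodule ℂ V) = ⊤ := congrArg Subrepresentation.toSubmodule h
          exact (Submodule.subsingleton_iff ℂ).mp (subsingleton_of_bot_eq_top h')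
        exact hρ ⟨hcon⟩
      push Not at hp
      obtain ⟨q, hpq⟩ := exists_isCompl p
      have hc : IsCompl p.toSubmodule q.toSubmodule := by
        rw [isCompl_iff, disjoint_iff, codisjoint_iff] at hpq ⊢
        exact ⟨congrArg Subrepresentation.toSubmodule hpq.1,
          congrArg Subrepresentation.toSubmodule hpq.2⟩
      have hd := Submodule.finrank_add_eq_of_isCompl hc
      have hp0 : 0 < Module.finrank ℂ p.toSubmodule := by
        rw [Nat.pos_iff_ne_zero, Ne, Submodule.finrank_eq_zero]
        exact fun h => hp.1 (Subrepresentation.toSubmodule_injective h)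
      have hp1 : Module.finrank ℂ p.toSubmodule < Module.finrank ℂ V := by
        refine Submodule.finrank_lt fun h => hp.2 (Subrepresentation.toSubmodule_injective h)
      have hadd := Representation.character_eq_add_of_isCompl ρ p q hc
      have hm := fun j => repMultiplicity_of_character_eq_add (γ j) ρ _ _ hadd
      simp only [hm, add_mul, Finset.sum_add_distrib]
      rw [hadd, ih _ p.toRepresentation (by omega), ih _ q.toRepresentation (by omega)]

/-- A character is the combination of the irreducible characters with the multiplicities as
coefficients. -/
theorem IsIrrepSystem.character_eq_sum [Finite G] (hγ : IsIrrepSystem γ) {V : Type*}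
    [AddCommGroup V] [Module ℂ V] [FiniteDimensional ℂ V] (ρ : Representation ℂ G V) (g : G) :
    ρ.character g = ∑ j, (repMultiplicity (γ j) ρ : ℂ) * (γ j).character g := by
  have := hγ.finiteDimensional
  have := Fintype.ofFinite G
  -- `IsIrrepSystem.complete` only speaks of spaces in `Type`, so `ρ` is moved to `Fin n → ℂ`.
  let e : V ≃ₗ[ℂ] (Fin (Module.finrank ℂ V) → ℂ) := (Module.finBasis ℂ V).equivFun
  let ρ' : Representation ℂ G (Fin (Module.finrank ℂ V) → ℂ) :=
    { toFun := fun g => e.conj (ρ g)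
      map_one' := by ext; simp
      map_mul' := fun g h => by ext; simp [LinearEquiv.conj_apply] }
  have h : ρ.character = ρ'.character := by
    ext g
    exact (LinearMap.trace_conj' (ρ g) e).symm
  have := hγ.character_eq_sum_of_type_zero _ _ ρ' le_rfl g
  simp only [repMultiplicity_eq_sum] at this ⊢
  rw [h, this]

end IrrepSystem

/-! ### Multigraded polynomial rings and the trace of a diagonal substitution -/

section Multigraded

open MvPolynomial

variable {ι κ : Type*} [Fintype ι]

/-- The exponents of the monomials of multidegree `e` in the polynomial ring in which the
variable `i` has the multidegree of `s i`. -/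
abbrev ExponentsOfDegree (s : ι → κ) (e : κ →₀ ℕ) : Type _ :=
  {d : ι →₀ ℕ // Finsupp.weight (fun i => Finsupp.single (s i) 1) d = e}

/-- The polynomials of multidegree `e`, where the variable `i` has the multidegree of `s i`. -/
noncomputable abbrev multigradedPart (s : ι → κ) (e : κ →₀ ℕ) :
    Submodule ℂ (MvPolynomial ι ℂ) :=
  weightedHomogeneousSubmodule ℂ (fun i => Finsupp.single (s i) 1) e

theorem weight_single_eq_sum (s : ι → κ) (d : ι →₀ ℕ) :
    Finsupp.weight (fun i => Finsupp.single (s i) 1) d = ∑ i, Finsupp.single (s i) (d i) := by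
  rw [Finsupp.weight_eq_sum]
  simp

instance (s : ι → κ) (e : κ →₀ ℕ) : Finite (ExponentsOfDegree s e) := by
  refine ((Finsupp.finite_of_degree_eq (σ := ι) e.degree).subset ?_).to_subtype
  rintro d rfl
  rw [weight_single_eq_sum]
  simp [Finsupp.degree_eq_sum]

noncomputable instance (s : ι → κ) (e : κ →₀ ℕ) : Fintype (ExponentsOfDegree s e) :=
  Fintype.ofFinite _

/-- A polynomial of multidegree `e` is the same thing as the family of its coefficients. -/
noncomputable def coeffEquiv (s : ι → κ) (e : κ →₀ ℕ) :
    multigradedPart s e ≃ₗ[ℂ] (ExponentsOfDegree s e → ℂ) where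
  toFun p d := coeff d.1 p.1
  map_add' p q := by ext; simp
  map_smul' c p := by ext; simp
  invFun f := ⟨∑ d, monomial d.1 (f d), Submodule.sum_mem _ fun d _ =>
    isWeightedHomogeneous_monomial _ _ _ d.2⟩
  left_inv p := by
    classical
    ext d
    simp only [coeff_sum, coeff_monomial]
    by_cases hd : Finsupp.weight (fun i => Finsupp.single (s i) 1) d = e
    · rw [Finset.sum_eq_single ⟨d, hd⟩]
      · simp
      · intro b _ hb
        rw [if_neg fun h => hb (Subtype.ext h)]
      · simp
    · rw [Finset.sum_eq_zero, p.2.coeff_eq_zero d hd]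
      intro b _
      rw [if_neg]
      rintro rfl
      exact hd b.2
  right_inv f := by
    classical
    ext d
    simp only [coeff_sum, coeff_monomial]
    rw [Finset.sum_eq_single d]
    · simp
    · intro b _ hb
      rw [if_neg fun h => hb (Subtype.ext h)]
    · simp

@[simp]
theorem coeffEquiv_apply (s : ι → κ) (e : κ →₀ ℕ) (p : multigradedPart s e)
    (d : ExponentsOfDegree s e) : coeffEquiv s e p d = coeff d.1 p.1 := rfl

instance (s : ι → κ) (e : κ →₀ ℕ) : FiniteDimensional ℂ (multigradedPart s e) :=
  (coeffEquiv s e).symm.finiteDimensional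

/-- A diagonal substitution is diagonal on monomials. -/
theorem coeff_aeval_C_mul_X (c : ι → ℂ) (p : MvPolynomial ι ℂ) (d : ι →₀ ℕ) :
    coeff d (aeval (fun i => C (c i) * X i) p : MvPolynomial ι ℂ) =
      (∏ i, c i ^ d i) * coeff d p := by
  classical
  induction p using MvPolynomial.induction_on' with
  | monomial u a =>
    have h : (aeval (fun i => C (c i) * X i) (monomial u a) : MvPolynomial ι ℂ) =
        C (∏ i, c i ^ u i) * monomial u a := by
      rw [aeval_monomial, monomial_eq, Finsupp.prod_fintype _ _ (by simp),
        Finsupp.prod_fintype _ _ (by simp)]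
      simp only [mul_pow, Finset.prod_mul_distrib, algebraMap_eq, map_prod, map_pow]
      ring
    rw [h, coeff_C_mul, coeff_monomial]
    split_ifs with hu
    · rw [hu]
    · simp
  | add p q hp hq => rw [map_add, coeff_add, hp, hq, coeff_add, mul_add]

/-- A substitution that replaces each variable by a polynomial of the same multidegree preserves
the multigraded parts. -/
theorem aeval_mem_multigradedPart (s : ι → κ) (e : κ →₀ ℕ) (f : ι → MvPolynomial ι ℂ)
    (hf : ∀ i, f i ∈ multigradedPart s (Finsupp.single (s i) 1)) {p : MvPolynomial ι ℂ}
    (hp : p ∈ multigradedPart s e) : aeval f p ∈ multigradedPart s e := by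
  refine IsWeightedHomogeneous.induction_on
    (motive := fun p _ => aeval f p ∈ multigradedPart s e) ?_ ?_ ?_ hp
  · rw [map_zero]
    exact Submodule.zero_mem _
  · intro p q _ _ hp hq
    rw [map_add]
    exact Submodule.add_mem _ hp hq
  · intro d r hd
    rw [aeval_monomial, Finsupp.prod_fintype _ _ (by simp), ← hd, Finsupp.weight_eq_sum]
    exact (IsWeightedHomogeneous.prod _ _ _ fun i _ => (hf i).pow (d i)).C_mul r

/-- The trace of an endomorphism whose matrix on monomials is diagonal. -/
theorem trace_restrict_multigradedPart_of_coeff (s : ι → κ) (e : κ →₀ ℕ) (c : (ι →₀ ℕ) → ℂ)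
    (T : MvPolynomial ι ℂ →ₗ[ℂ] MvPolynomial ι ℂ)
    (hT : ∀ p ∈ multigradedPart s e, T p ∈ multigradedPart s e)
    (hc : ∀ p d, coeff d (T p) = c d * coeff d p) :
    LinearMap.trace ℂ _ (T.restrict hT) = ∑ d : ExponentsOfDegree s e, c d.1 := by
  classical
  rw [LinearMap.trace_eq_matrix_trace ℂ (Module.Basis.ofEquivFun (coeffEquiv s e)), Matrix.trace]
  refine Finset.sum_congr rfl fun d _ => ?_
  rw [Matrix.diag_apply, LinearMap.toMatrix_apply, Module.Basis.ofEquivFun_repr_apply,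
    coeffEquiv_apply, LinearMap.coe_restrict_apply, hc, ← coeffEquiv_apply,
    Module.Basis.coe_ofEquivFun, LinearEquiv.apply_symm_apply]
  simp

open scoped Classical in
/-- The geometric series `∑ cⁿ Xₖⁿ` in one of the variables of a power series ring. -/
noncomputable def geometricSeries (c : ℂ) (k : κ) : MvPowerSeries κ ℂ :=
  fun e => if e = Finsupp.single k (e k) then c ^ e k else 0

open scoped Classical in
theorem coeff_geometricSeries (c : ℂ) (k : κ) (e : κ →₀ ℕ) :
    MvPowerSeries.coeff e (geometricSeries c k) =
      if e = Finsupp.single k (e k) then c ^ e k else 0 := rfl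

theorem one_sub_mul_geometricSeries (c : ℂ) (k : κ) :
    (1 - MvPowerSeries.C c * MvPowerSeries.X k) * geometricSeries c k = 1 := by
  classical
  ext e
  have h : (MvPowerSeries.C c : MvPowerSeries κ ℂ) * MvPowerSeries.X k =
      MvPowerSeries.monomial (Finsupp.single k 1) c := by
    rw [MvPowerSeries.X, ← MvPowerSeries.monomial_zero_eq_C_apply,
      MvPowerSeries.monomial_mul_monomial]
    simp
  rw [sub_mul, one_mul, h, map_sub, MvPowerSeries.coeff_monomial_mul, MvPowerSeries.coeff_one]
  simp only [coeff_geometricSeries]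
  by_cases h0 : e = 0
  · subst h0
    simp
  rw [if_neg h0]
  by_cases he : e = Finsupp.single k (e k)
  · have hk : 1 ≤ e k := by
      rw [Nat.one_le_iff_ne_zero]
      intro hk
      rw [hk, Finsupp.single_zero] at he
      exact h0 he
    rw [if_pos (Finsupp.single_le_iff.mpr hk), if_pos he, if_pos]
    · rw [Finsupp.tsub_apply, Finsupp.single_eq_same, ← pow_succ', Nat.sub_add_cancel hk, sub_self]
    · conv_lhs => rw [he, ← Finsupp.single_tsub]
      simp
  · rw [if_neg he]
    split_ifs with h1 h2
    · exfalso
      apply he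
      conv_lhs => rw [← tsub_add_cancel_of_le h1, h2, ← Finsupp.single_add]
      congr 1
      have := Finsupp.single_le_iff.mp h1
      simp [Nat.sub_add_cancel this]
    · simp
    · simp

/-- The generating series of the traces of a diagonal substitution on the multigraded parts: the
coefficient at `e` is the sum of the monomials of multidegree `e`, evaluated at `c`. -/
noncomputable def monomialSumSeries (s : ι → κ) (c : ι → ℂ) : MvPowerSeries κ ℂ :=
  fun e => ∑ d : ExponentsOfDegree s e, ∏ i, c i ^ d.1 i

theorem coeff_monomialSumSeries (s : ι → κ) (c : ι → ℂ) (e : κ →₀ ℕ) :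
    MvPowerSeries.coeff e (monomialSumSeries s c) =
      ∑ d : ExponentsOfDegree s e, ∏ i, c i ^ d.1 i := rfl

/-- The generating series of the sums of monomials is a product of geometric series, one for each
variable. -/
theorem prod_one_sub_mul_monomialSumSeries (s : ι → κ) (c : ι → ℂ) :
    (∏ i, (1 - MvPowerSeries.C (c i) * MvPowerSeries.X (s i))) * monomialSumSeries s c = 1 := by
  classical
  suffices h : monomialSumSeries s c = ∏ i, geometricSeries (c i) (s i) by
    rw [h, ← Finset.prod_mul_distrib]
    exact Finset.prod_eq_one fun i _ => one_sub_mul_geometricSeries _ _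
  refine MvPowerSeries.ext fun e => ?_
  rw [MvPowerSeries.coeff_prod]
  simp only [coeff_monomialSumSeries, coeff_geometricSeries]
  refine Finset.sum_of_injOn
    (fun d => Finsupp.equivFunOnFinite.symm fun i => Finsupp.single (s i) (d.1 i)) ?_ ?_ ?_ ?_
  · intro d _ d' _ h
    ext i
    have := DFunLike.congr_fun (DFunLike.congr_fun h i) (s i)
    simpa using this
  · intro d _
    rw [Finset.mem_coe, Finset.mem_finsuppAntidiag]
    refine ⟨?_, Finset.subset_univ _⟩
    refine Eq.trans ?_ d.2
    rw [weight_single_eq_sum]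
    rfl
  · intro f hf hf'
    by_contra hne
    have h := fun i => Finset.prod_ne_zero_iff.mp hne i (Finset.mem_univ i)
    have h' : ∀ i, f i = Finsupp.single (s i) (f i (s i)) := fun i => by
      by_contra hi
      exact h i (if_neg hi)
    apply hf'
    rw [Finset.mem_finsuppAntidiag] at hf
    refine ⟨⟨Finsupp.equivFunOnFinite.symm fun i => f i (s i), ?_⟩,
      Finset.mem_coe.mpr (Finset.mem_univ _), ?_⟩
    · rw [weight_single_eq_sum, ← hf.1]
      exact Finset.sum_congr rfl fun i _ => (h' i).symm
    · ext1 i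
      exact (h' i).symm
  · intro d _
    refine Finset.prod_congr rfl fun i _ => ?_
    simp

end Multigraded

/-! ### The bigraded pieces of `Sym(ℂ³) ⊗ Sym((ℂ³)*)` and their characters -/

/-- An endomorphism of finite order of a finite-dimensional complex vector space has a basis of
eigenvectors. -/
theorem exists_basis_eigenvectors_of_pow_eq_one {V ι : Type*} [AddCommGroup V] [Module ℂ V]
    [Finite ι] (b₀ : Module.Basis ι ℂ V) (f : Module.End ℂ V) {n : ℕ} (hn : n ≠ 0)
    (hf : f ^ n = 1) : ∃ (b : Module.Basis ι ℂ V) (c : ι → ℂ), ∀ i, f (b i) = c i • b i := by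
  classical
  have : FiniteDimensional ℂ V := Module.Finite.of_basis b₀
  have hs : f.IsSemisimple := by
    refine Module.End.isSemisimple_of_squarefree_aeval_eq_zero
      (p := Polynomial.X ^ n - Polynomial.C 1) ?_ (by simp [hf])
    exact (Polynomial.separable_X_pow_sub_C 1 (Nat.cast_ne_zero.mpr hn) one_ne_zero).squarefree
  have hi : DirectSum.IsInternal f.eigenspace :=
    (DirectSum.isInternal_submodule_iff_iSupIndep_and_iSup_eq_top _).mpr
      ⟨f.eigenspaces_iSupIndep, hs.iSup_eigenspace_eq_top⟩
  let b := hi.collectedBasis fun μ => Module.finBasis ℂ (f.eigenspace μ)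
  refine ⟨b.reindex (b.indexEquiv b₀), fun i => ((b.indexEquiv b₀).symm i).1, fun i => ?_⟩
  rw [Module.Basis.reindex_apply]
  exact Module.End.mem_eigenspace_iff.mp (hi.collectedBasis_mem _ _)

/-- A square matrix of finite order is diagonalizable. -/
theorem Matrix.exists_diagonalization_of_pow_eq_one {m : ℕ} (A : Matrix (Fin m) (Fin m) ℂ) {n : ℕ}
    (hn : n ≠ 0) (hA : A ^ n = 1) : ∃ (P Q : Matrix (Fin m) (Fin m) ℂ) (c : Fin m → ℂ),
      P * Q = 1 ∧ Q * P = 1 ∧ A = P * Matrix.diagonal c * Q := by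
  obtain ⟨b, c, h⟩ := exists_basis_eigenvectors_of_pow_eq_one (Pi.basisFun ℂ (Fin m))
    (Matrix.toLin' A) hn (by rw [← Matrix.toLin'_pow, hA, Matrix.toLin'_one]; rfl)
  refine ⟨(Pi.basisFun ℂ (Fin m)).toMatrix b, b.toMatrix (Pi.basisFun ℂ (Fin m)), c,
    Module.Basis.toMatrix_mul_toMatrix_flip _ _, Module.Basis.toMatrix_mul_toMatrix_flip _ _, ?_⟩
  have hd : LinearMap.toMatrix b b (Matrix.toLin' A) = Matrix.diagonal c := by
    ext i j
    rw [LinearMap.toMatrix_apply, h, Matrix.diagonal_apply]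
    by_cases hij : i = j <;> simp [hij]
  rw [← hd, basis_toMatrix_mul_linearMap_toMatrix_mul_basis_toMatrix,
    LinearMap.toMatrix_eq_toMatrix', LinearMap.toMatrix'_toLin']

open MvPolynomial ComplexConjugate

/-- The position in the bidegree counted by a variable of `SymPair`: `0` for `eᵢ` and `1` for
`eᵢ*`. -/
def pairSlot : Fin 3 ⊕ Fin 3 → Fin 2 := Sum.elim (fun _ => 0) fun _ => 1

@[simp] theorem pairSlot_inl (i : Fin 3) : pairSlot (Sum.inl i) = 0 := rfl

@[simp] theorem pairSlot_inr (i : Fin 3) : pairSlot (Sum.inr i) = 1 := rfl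

/-- The part `Symᵐ(ℂ³) ⊗ Symⁿ((ℂ³)*)` of bidegree `e = (m, n)` of `SymPair`. -/
noncomputable abbrev bidegreePart (e : Fin 2 →₀ ℕ) : Submodule ℂ SymPair :=
  multigradedPart pairSlot e

/-- The action on `SymPair` of a pair of matrices, the first acting on `ℂ³` and the second,
transposed, on `(ℂ³)*`. Unlike `symPairAct` it does not require the matrices to be inverse to each
other or to have determinant `1`. -/
noncomputable def pairAct (A B : Matrix (Fin 3) (Fin 3) ℂ) : SymPair →ₐ[ℂ] SymPair :=
  aeval (Sum.elim (fun i => ∑ j, C (A j i) * X (Sum.inl j))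
    fun i => ∑ j, C (B i j) * X (Sum.inr j))

theorem symPairAct_eq_pairAct (g : SL3) :
    symPairAct g = pairAct (g : Matrix (Fin 3) (Fin 3) ℂ) (g⁻¹ : SL3) := rfl

theorem pairAct_X_inl (A B : Matrix (Fin 3) (Fin 3) ℂ) (i : Fin 3) :
    pairAct A B (X (Sum.inl i)) = ∑ j, C (A j i) * X (Sum.inl j) := by
  simp [pairAct]

theorem pairAct_X_inr (A B : Matrix (Fin 3) (Fin 3) ℂ) (i : Fin 3) :
    pairAct A B (X (Sum.inr i)) = ∑ j, C (B i j) * X (Sum.inr j) := by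
  simp [pairAct]

theorem pairAct_one : pairAct 1 1 = AlgHom.id ℂ SymPair := by
  simpa [symPairAct_eq_pairAct] using symPairAct_one

theorem pairAct_comp (A B A' B' : Matrix (Fin 3) (Fin 3) ℂ) :
    (pairAct A B).comp (pairAct A' B') = pairAct (A * A') (B' * B) := by
  refine MvPolynomial.algHom_ext ?_
  rintro (i | i)
  · simp only [AlgHom.comp_apply, pairAct_X_inl, map_mul, MvPolynomial.algHom_C,
      MvPolynomial.algebraMap_eq, Matrix.mul_apply, Fin.sum_univ_three, map_add]
    ring
  · simp only [AlgHom.comp_apply, pairAct_X_inr, map_mul, MvPolynomial.algHom_C,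
      MvPolynomial.algebraMap_eq, Matrix.mul_apply, Fin.sum_univ_three, map_add]
    ring

theorem pairAct_diagonal (c c' : Fin 3 → ℂ) :
    pairAct (Matrix.diagonal c) (Matrix.diagonal c') =
      aeval fun i => C (Sum.elim c c' i) * X i := by
  refine MvPolynomial.algHom_ext ?_
  rintro (i | i)
  · rw [pairAct_X_inl, aeval_X, Finset.sum_eq_single i]
    · simp
    · intro j _ hj
      simp [Matrix.diagonal_apply_ne _ hj]
    · simp
  · rw [pairAct_X_inr, aeval_X, Finset.sum_eq_single i]
    · simp
    · intro j _ hj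
      simp [Matrix.diagonal_apply_ne _ hj.symm]
    · simp

theorem pairAct_mem_bidegreePart (A B : Matrix (Fin 3) (Fin 3) ℂ) (e : Fin 2 →₀ ℕ) {p : SymPair}
    (hp : p ∈ bidegreePart e) : pairAct A B p ∈ bidegreePart e := by
  refine aeval_mem_multigradedPart _ _ _ ?_ hp
  rintro (i | i)
  · exact Submodule.sum_mem _ fun j _ => (isWeightedHomogeneous_X ℂ _ (Sum.inl j)).C_mul _
  · exact Submodule.sum_mem _ fun j _ => (isWeightedHomogeneous_X ℂ _ (Sum.inr j)).C_mul _

/-- The action of a pair of matrices on a bigraded piece of `SymPair`. -/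
noncomputable def bidegreeAct (A B : Matrix (Fin 3) (Fin 3) ℂ) (e : Fin 2 →₀ ℕ) :
    Module.End ℂ (bidegreePart e) :=
  (pairAct A B).toLinearMap.restrict fun _ => pairAct_mem_bidegreePart A B e

theorem bidegreeAct_mul (A B A' B' : Matrix (Fin 3) (Fin 3) ℂ) (e : Fin 2 →₀ ℕ) :
    bidegreeAct (A * A') (B' * B) e = bidegreeAct A B e * bidegreeAct A' B' e := by
  ext p : 2
  exact DFunLike.congr_fun (pairAct_comp A B A' B').symm p.1

theorem bidegreeAct_one (e : Fin 2 →₀ ℕ) : bidegreeAct 1 1 e = 1 := by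
  ext p : 2
  exact DFunLike.congr_fun pairAct_one p.1

/-- For an element of finite order of `SL₃(ℂ)`, with eigenvalues `c₀, c₁, c₂`, the traces on the
bigraded pieces of `SymPair` are the sums of the monomials in the `cᵢ` and `cᵢ⁻¹`. -/
theorem exists_eigenvalues_of_isOfFinOrder (g : SL3) (hg : IsOfFinOrder g) :
    ∃ c : Fin 3 → ℂ, c 0 * c 1 * c 2 = 1 ∧
      (g : Matrix (Fin 3) (Fin 3) ℂ).trace = c 0 + c 1 + c 2 ∧
      ((g⁻¹ : SL3) : Matrix (Fin 3) (Fin 3) ℂ).trace = (c 0)⁻¹ + (c 1)⁻¹ + (c 2)⁻¹ ∧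
      ∀ e, LinearMap.trace ℂ _ (bidegreeAct (g : Matrix (Fin 3) (Fin 3) ℂ) (g⁻¹ : SL3) e) =
        MvPowerSeries.coeff e (monomialSumSeries pairSlot (Sum.elim c c⁻¹)) := by
  obtain ⟨n, hn, hgn⟩ := isOfFinOrder_iff_pow_eq_one.mp hg
  obtain ⟨P, Q, c, hPQ, hQP, h⟩ := Matrix.exists_diagonalization_of_pow_eq_one
    (g : Matrix (Fin 3) (Fin 3) ℂ) hn.ne' (by rw [← Matrix.SpecialLinearGroup.coe_pow, hgn]; simp)
  have hdet : c 0 * c 1 * c 2 = 1 := by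
    have h1 := g.2
    have h2 : P.det * Q.det = 1 := by rw [← Matrix.det_mul, hPQ, Matrix.det_one]
    rw [h, Matrix.det_mul, Matrix.det_mul, Matrix.det_diagonal, Fin.prod_univ_three] at h1
    linear_combination h1 - c 0 * c 1 * c 2 * h2
  have hc : ∀ i, c i ≠ 0 := by
    intro i hi
    fin_cases i <;> simp_all
  have hinv : ((g⁻¹ : SL3) : Matrix (Fin 3) (Fin 3) ℂ) = P * Matrix.diagonal c⁻¹ * Q := by
    have h1 : (g : Matrix (Fin 3) (Fin 3) ℂ) * (P * Matrix.diagonal c⁻¹ * Q) = 1 := by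
      have h2 : Matrix.diagonal c * Matrix.diagonal c⁻¹ = 1 := by
        rw [Matrix.diagonal_mul_diagonal, ← Matrix.diagonal_one]
        congr 1
        ext i
        simp [hc i]
      calc (g : Matrix (Fin 3) (Fin 3) ℂ) * (P * Matrix.diagonal c⁻¹ * Q)
          = P * (Matrix.diagonal c * (Q * P) * Matrix.diagonal c⁻¹) * Q := by
            rw [h]
            simp only [Matrix.mul_assoc]
        _ = 1 := by rw [hQP, Matrix.mul_one, h2, Matrix.mul_one, hPQ]
    have h3 : ((g⁻¹ : SL3) : Matrix (Fin 3) (Fin 3) ℂ) * (g : Matrix (Fin 3) (Fin 3) ℂ) = 1 := by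
      rw [← Matrix.SpecialLinearGroup.coe_mul, inv_mul_cancel, Matrix.SpecialLinearGroup.coe_one]
    exact left_inv_eq_right_inv h3 h1
  have htr : ∀ d : Fin 3 → ℂ, (P * Matrix.diagonal d * Q).trace = d 0 + d 1 + d 2 := fun d => by
    rw [Matrix.trace_mul_comm, ← Matrix.mul_assoc, hQP, Matrix.one_mul, Matrix.trace_diagonal,
      Fin.sum_univ_three]
  refine ⟨c, hdet, by rw [h, htr], by rw [hinv, htr]; rfl, fun e => ?_⟩
  rw [h, hinv, Matrix.mul_assoc P _ Q, bidegreeAct_mul, bidegreeAct_mul, LinearMap.trace_mul_comm,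
    mul_assoc, ← bidegreeAct_mul, hQP, bidegreeAct_one, mul_one]
  exact trace_restrict_multigradedPart_of_coeff _ _ (fun d => ∏ i, Sum.elim c c⁻¹ i ^ d i) _ _
    fun p d => by rw [pairAct_diagonal]; exact coeff_aeval_C_mul_X _ _ _

/-- The generating function of the characters of the bigraded pieces: the denominators are
`det (1 - t g)` and `det (1 - u g⁻¹)`. -/
theorem charpoly_mul_monomialSumSeries (c : Fin 3 → ℂ) (hc : c 0 * c 1 * c 2 = 1) (x y : ℂ)
    (hx : x = c 0 + c 1 + c 2) (hy : y = (c 0)⁻¹ + (c 1)⁻¹ + (c 2)⁻¹)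
    (t u : MvPowerSeries (Fin 2) ℂ) (ht : t = MvPowerSeries.X 0) (hu : u = MvPowerSeries.X 1) :
    (1 - t * MvPowerSeries.C x + t ^ 2 * MvPowerSeries.C y - t ^ 3) *
      (1 - u * MvPowerSeries.C y + u ^ 2 * MvPowerSeries.C x - u ^ 3) *
      monomialSumSeries pairSlot (Sum.elim c c⁻¹) = 1 := by
  have h := prod_one_sub_mul_monomialSumSeries pairSlot (Sum.elim c c⁻¹)
  rw [Fintype.prod_sum_type, Fin.prod_univ_three, Fin.prod_univ_three] at h
  simp only [pairSlot_inl, pairSlot_inr, Sum.elim_inl, Sum.elim_inr, ← ht, ← hu] at h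
  have hne : ∀ i, c i ≠ 0 := by
    intro i hi
    fin_cases i <;> simp_all
  have hx' : x = (c⁻¹) 0 * (c⁻¹) 1 + (c⁻¹) 0 * (c⁻¹) 2 + (c⁻¹) 1 * (c⁻¹) 2 := by
    have := hne 0
    have := hne 1
    have := hne 2
    simp only [Pi.inv_apply, hx]
    field_simp
    linear_combination (c 0 + c 1 + c 2) * hc
  have hy' : y = c 0 * c 1 + c 0 * c 2 + c 1 * c 2 := by
    have := hne 0
    have := hne 1
    have := hne 2
    rw [hy]
    field_simp
    linear_combination -(c 0 * c 1 + c 0 * c 2 + c 1 * c 2) * hc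
  have hc' : (c⁻¹) 0 * (c⁻¹) 1 * (c⁻¹) 2 = 1 := by
    simp only [Pi.inv_apply]
    rw [← mul_inv, ← mul_inv, hc, inv_one]
  have e1 : 1 - t * MvPowerSeries.C x + t ^ 2 * MvPowerSeries.C y - t ^ 3 =
      (1 - MvPowerSeries.C (c 0) * t) * (1 - MvPowerSeries.C (c 1) * t) *
        (1 - MvPowerSeries.C (c 2) * t) := by
    have := congrArg (MvPowerSeries.C (σ := Fin 2)) hc
    rw [hx, hy']
    simp only [map_mul, map_add, map_one] at this ⊢
    linear_combination t ^ 3 * this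
  have e2 : 1 - u * MvPowerSeries.C y + u ^ 2 * MvPowerSeries.C x - u ^ 3 =
      (1 - MvPowerSeries.C ((c⁻¹) 0) * u) * (1 - MvPowerSeries.C ((c⁻¹) 1) * u) *
        (1 - MvPowerSeries.C ((c⁻¹) 2) * u) := by
    have := congrArg (MvPowerSeries.C (σ := Fin 2)) hc'
    rw [hx', hy]
    simp only [map_mul, map_add, map_one, ← Pi.inv_apply] at this ⊢
    linear_combination u ^ 3 * this
  rw [e1, e2, h]

/-! ### The invariant quadric -/

/-- The contraction `∑ eᵢ eᵢ*`, a quadratic form on `ℂ³ ⊕ (ℂ³)*` invariant under `SL₃(ℂ)`. -/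
noncomputable def contraction : SymPair := ∑ i, X (Sum.inl i) * X (Sum.inr i)

/-- The bidegree `(1, 1)` of the contraction. -/
noncomputable def bidegreeOne : Fin 2 →₀ ℕ := Finsupp.single 0 1 + Finsupp.single 1 1

theorem contraction_mem : contraction ∈ bidegreePart bidegreeOne :=
  Submodule.sum_mem _ fun i _ =>
    (isWeightedHomogeneous_X ℂ _ (Sum.inl i)).mul (isWeightedHomogeneous_X ℂ _ (Sum.inr i))

theorem eval_contraction (v : Fin 3 ⊕ Fin 3 → ℂ) :
    eval v contraction = ∑ i, v (Sum.inl i) * v (Sum.inr i) := by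
  simp [contraction]

theorem contraction_ne_zero : contraction ≠ 0 := by
  intro h
  have := eval_contraction fun _ => 1
  simp [h] at this

theorem symPairAct_contraction (g : SL3) : symPairAct g contraction = contraction := by
  have h : (g : Matrix (Fin 3) (Fin 3) ℂ) * (g⁻¹ : SL3) = 1 := by
    rw [← Matrix.SpecialLinearGroup.coe_mul, mul_inv_cancel, Matrix.SpecialLinearGroup.coe_one]
  have h' : ∀ j k, ∑ i, g j i * (g⁻¹ : SL3) i k = if j = k then 1 else 0 := fun j k => by
    rw [← Matrix.one_apply, ← h, Matrix.mul_apply]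
  simp only [contraction, map_sum, map_mul, symPairAct_X_inl, symPairAct_X_inr]
  calc _ = ∑ j, ∑ k, C (∑ i, g j i * (g⁻¹ : SL3) i k) * (X (Sum.inl j) * X (Sum.inr k)) := by
        simp only [Fin.sum_univ_three, map_add, map_mul]
        ring
    _ = _ := by
        simp only [h', apply_ite C, map_one, map_zero, ite_mul, one_mul, zero_mul,
          Finset.sum_ite_eq, Finset.mem_univ, if_true]

/-- Rescaling the variables by a factor that depends only on their multidegree rescales a
multihomogeneous polynomial. -/
theorem aeval_mul_X_of_mem_multigradedPart {ι κ : Type*} [Fintype ι] [Fintype κ] (s : ι → κ)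
    (e : κ →₀ ℕ) (τ : κ → MvPolynomial ι ℂ) {p : MvPolynomial ι ℂ}
    (hp : p ∈ multigradedPart s e) :
    aeval (fun i => τ (s i) * X i) p = (∏ k, τ k ^ e k) * p := by
  refine IsWeightedHomogeneous.induction_on
    (motive := fun p _ => aeval (fun i => τ (s i) * X i) p = (∏ k, τ k ^ e k) * p) ?_ ?_ ?_ hp
  · simp
  · intro p q _ _ hp hq
    rw [map_add, hp, hq, mul_add]
  · intro d r hd
    have h : ∏ i, τ (s i) ^ d i = ∏ k, τ k ^ e k := by
      classical
      rw [← hd, weight_single_eq_sum]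
      simp only [Finsupp.finsetSum_apply, ← Finset.prod_pow_eq_pow_sum]
      rw [Finset.prod_comm]
      refine Finset.prod_congr rfl fun i _ => ?_
      rw [Finset.prod_eq_single (s i)]
      · simp
      · intro k _ hk
        simp [Ne.symm hk]
      · simp
    rw [aeval_monomial, monomial_eq, Finsupp.prod_fintype _ _ (by simp),
      Finsupp.prod_fintype _ _ (by simp), ← h]
    simp only [mul_pow, Finset.prod_mul_distrib, algebraMap_eq]
    ring

theorem eval_aeval_eq_eval {ι : Type*} (v : ι → ℂ) (f : ι → MvPolynomial ι ℂ)
    (p : MvPolynomial ι ℂ) : eval v (aeval f p) = eval (fun i => eval v (f i)) p := by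
  induction p using MvPolynomial.induction_on with
  | C a => simp
  | add p q hp hq => rw [map_add, map_add, map_add, hp, hq]
  | mul_X p i hp => rw [map_mul, map_mul, map_mul, hp, aeval_X, eval_X]

/-- A polynomial vanishes on the cone of the pairs `(a, b)` of nonzero vectors with
`∑ aᵢ bᵢ = 0`. -/
def VanishesOnCone (p : SymPair) : Prop :=
  ∀ a b : Fin 3 → ℂ, a ≠ 0 → b ≠ 0 → ∑ i, a i * b i = 0 → eval (Sum.elim a b) p = 0

/-- The ideal of the cone is generated by the contraction. -/
theorem contraction_dvd_of_vanishesOnCone {e : Fin 2 →₀ ℕ} {p : SymPair}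
    (hp : p ∈ bidegreePart e) (h : VanishesOnCone p) : contraction ∣ p := by
  -- Modulo the contraction, `e₀* e₀` is `-(e₁ e₁* + e₂ e₂*)`, so that `(e₀*)ᵐ p` agrees with
  -- the polynomial `aeval f p` below, which does not involve `e₀`.
  let y : SymPair := X (Sum.inr 0)
  let f : Fin 3 ⊕ Fin 3 → SymPair := Sum.elim
    ![-(X (Sum.inl 1) * X (Sum.inr 1) + X (Sum.inl 2) * X (Sum.inr 2)), y * X (Sum.inl 1),
      y * X (Sum.inl 2)] fun i => X (Sum.inr i)
  have h1 : contraction ∣ y ^ e 0 * p - aeval f p := by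
    have h2 := aeval_mul_X_of_mem_multigradedPart pairSlot e ![y, 1] hp
    rw [Fin.prod_univ_two] at h2
    simp only [Matrix.cons_val_zero, Matrix.cons_val_one, one_pow, mul_one] at h2
    rw [← h2, ← Ideal.mem_span_singleton, ← Ideal.Quotient.mk_eq_mk_iff_sub_mem]
    have h3 : (Ideal.Quotient.mkₐ ℂ (Ideal.span {contraction})).comp
          (aeval fun i => ![y, 1] (pairSlot i) * X i) =
        (Ideal.Quotient.mkₐ ℂ (Ideal.span {contraction})).comp (aeval f) := by
      refine MvPolynomial.algHom_ext ?_
      rintro (i | i)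
      · simp only [AlgHom.comp_apply, aeval_X, Ideal.Quotient.mkₐ_eq_mk]
        rw [Ideal.Quotient.mk_eq_mk_iff_sub_mem, Ideal.mem_span_singleton]
        fin_cases i
        · refine ⟨1, ?_⟩
          simp [f, y, contraction, Fin.sum_univ_three]
          ring
        · simp [f]
        · simp [f]
      · simp [f]
    exact DFunLike.congr_fun h3 p
  -- `aeval f p` vanishes: `f` maps the points with `e₀*, e₁ ≠ 0` into the cone.
  have h2 : aeval f p = 0 := by
    have h3 : aeval f p * (y * X (Sum.inl 1)) = 0 := by
      refine MvPolynomial.funext fun v => ?_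
      rw [map_mul, map_mul, map_zero, eval_aeval_eq_eval]
      by_cases hy : v (Sum.inr 0) = 0
      · simp [y, hy]
      by_cases hx : v (Sum.inl 1) = 0
      · simp [hx]
      have h4 : (fun i => eval v (f i)) = Sum.elim (fun i => eval v (f (Sum.inl i)))
          (fun i => eval v (f (Sum.inr i))) := by
        ext (i | i) <;> rfl
      rw [h4, h, zero_mul]
      · intro h0
        have := congrFun h0 1
        simp [f, y, hx, hy] at this
      · intro h0
        have := congrFun h0 0
        simp [f, hy] at this
      · simp [f, y, Fin.sum_univ_three]
        ring
    exact (mul_eq_zero.mp h3).resolve_right (mul_ne_zero (X_ne_zero _) (X_ne_zero _))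
  rw [h2, sub_zero] at h1
  obtain ⟨r, hr⟩ := h1
  -- The prime `e₀*` does not divide the contraction, so its power can be cancelled.
  have hy : ¬ y ∣ contraction := by
    rintro ⟨r, hr⟩
    have := congrArg (eval (Sum.elim (Pi.single 1 1) (Pi.single 1 1) : Fin 3 ⊕ Fin 3 → ℂ)) hr
    rw [eval_contraction] at this
    simp [y, Fin.sum_univ_three] at this
  obtain ⟨w, rfl⟩ := (X_prime (R := ℂ) (i := (Sum.inr 0 : Fin 3 ⊕ Fin 3))).pow_dvd_of_dvd_mul_left
    (e 0) hy ⟨p, hr.symm⟩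
  refine ⟨w, mul_left_cancel₀ (pow_ne_zero (e 0) (X_ne_zero (R := ℂ) (Sum.inr 0))) ?_⟩
  rw [hr]
  ring

/-- A bihomogeneous multiple of the contraction is the product with a bihomogeneous polynomial. -/
theorem exists_eq_contraction_mul {e : Fin 2 →₀ ℕ} {p : SymPair} (hp : p ∈ bidegreePart e)
    (h : contraction ∣ p) (he : bidegreeOne ≤ e) :
    ∃ r ∈ bidegreePart (e - bidegreeOne), p = contraction * r := by
  classical
  obtain ⟨r, rfl⟩ := h
  let : GradedAlgebra (multigradedPart pairSlot) := weightedGradedAlgebra ℂ _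
  refine ⟨_, (DirectSum.decompose (multigradedPart pairSlot) r (e - bidegreeOne)).2, ?_⟩
  rw [← DirectSum.coe_decompose_mul_of_left_mem_of_le _ contraction_mem he,
    DirectSum.decompose_of_mem_same _ hp]

/-- A bidegree with a zero component contains no nonzero multiple of the contraction. -/
theorem eq_zero_of_contraction_dvd {e : Fin 2 →₀ ℕ} {p : SymPair} (hp : p ∈ bidegreePart e)
    (h : contraction ∣ p) (he : ¬ bidegreeOne ≤ e) : p = 0 := by
  classical
  obtain ⟨r, rfl⟩ := h
  let : GradedAlgebra (multigradedPart pairSlot) := weightedGradedAlgebra ℂ _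
  rw [← DirectSum.decompose_of_mem_same (multigradedPart pairSlot) hp,
    DirectSum.coe_decompose_mul_of_left_mem_of_not_le _ contraction_mem he]

theorem exists_sum_mul_eq_one {a : Fin 3 → ℂ} (ha : a ≠ 0) :
    ∃ a' : Fin 3 → ℂ, ∑ i, a i * a' i = 1 := by
  obtain ⟨i, hi⟩ := Function.ne_iff.mp ha
  refine ⟨Pi.single i (a i)⁻¹, ?_⟩
  rw [Finset.sum_eq_single i]
  · simpa using mul_inv_cancel₀ hi
  · intro j _ hj
    simp [hj]
  · simp

/-- The group `SL₃(ℂ)` acts transitively on the cone. -/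
theorem exists_SL3_of_mem_cone {a b : Fin 3 → ℂ} (ha : a ≠ 0) (hb : b ≠ 0)
    (hab : ∑ i, a i * b i = 0) : ∃ g : SL3, (∀ i, g i 0 = a i) ∧ ∀ i, (g⁻¹ : SL3) 2 i = b i := by
  obtain ⟨a', ha'⟩ := exists_sum_mul_eq_one ha
  obtain ⟨b', hb'⟩ := exists_sum_mul_eq_one hb
  rw [Fin.sum_univ_three] at hab ha' hb'
  -- The columns are `a`, the cross product `b × a'` and `b'`; one has `a × (b × a') = b`.
  let A : Matrix (Fin 3) (Fin 3) ℂ :=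
    !![a 0, b 1 * a' 2 - b 2 * a' 1, b' 0;
       a 1, b 2 * a' 0 - b 0 * a' 2, b' 1;
       a 2, b 0 * a' 1 - b 1 * a' 0, b' 2]
  have hdet : A.det = 1 := by
    rw [Matrix.det_fin_three]
    simp only [A, Matrix.of_apply, Matrix.cons_val]
    linear_combination (b 0 * b' 0 + b 1 * b' 1 + b 2 * b' 2) * ha' + hb' -
      (a' 0 * b' 0 + a' 1 * b' 1 + a' 2 * b' 2) * hab
  let g : SL3 := ⟨A, hdet⟩
  refine ⟨g, fun i => by fin_cases i <;> rfl, ?_⟩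
  have h1 : b ᵥ* A = Pi.single 2 1 := by
    ext i
    rw [Matrix.vecMul, dotProduct, Fin.sum_univ_three]
    fin_cases i
    · simp only [A, Matrix.of_apply, Matrix.cons_val, Fin.zero_eta, Fin.isValue]
      simp only [Fin.isValue, Pi.single_apply, Fin.reduceEq, if_false]
      linear_combination hab
    · simp only [A, Matrix.of_apply, Matrix.cons_val, Fin.mk_one, Fin.isValue]
      simp only [Fin.isValue, Pi.single_apply, Fin.reduceEq, if_false]
      ring
    · simp only [A, Matrix.of_apply, Matrix.cons_val, Fin.reduceFinMk, Fin.isValue]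
      simp only [Fin.isValue, Pi.single_apply, if_true]
      linear_combination hb'
  have h2 : A * (g⁻¹ : SL3) = 1 := by
    have := congrArg (fun x : SL3 => (x : Matrix (Fin 3) (Fin 3) ℂ)) (mul_inv_cancel g)
    rwa [Matrix.SpecialLinearGroup.coe_mul, Matrix.SpecialLinearGroup.coe_one] at this
  intro i
  have h3 := congrFun (congrArg (fun v => v ᵥ* ((g⁻¹ : SL3) : Matrix (Fin 3) (Fin 3) ℂ)) h1) i
  simp only [Matrix.vecMul_vecMul, h2, Matrix.vecMul_one, Matrix.single_one_vecMul,
    Matrix.row_apply] at h3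
  exact h3.symm

/-! ### The Fischer inner product -/

theorem eval_eq_sum_of_mem_multigradedPart {ι κ : Type*} [Fintype ι] (s : ι → κ) (e : κ →₀ ℕ)
    (c : ι → ℂ) (p : multigradedPart s e) :
    eval c p.1 = ∑ d : ExponentsOfDegree s e, coeff d.1 p.1 * ∏ i, c i ^ d.1 i := by
  have h := congrArg (fun q : multigradedPart s e => eval c q.1)
    ((coeffEquiv s e).symm_apply_apply p)
  rw [← h]
  change eval c (∑ d : ExponentsOfDegree s e, monomial d.1 (coeff d.1 p.1)) = _
  rw [map_sum]
  refine Finset.sum_congr rfl fun d _ => ?_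
  rw [eval_monomial, Finsupp.prod_fintype _ _ (by simp)]

/-- The product `(∑ aᵢ eᵢ)ᵐ (∑ bᵢ eᵢ*)ⁿ`, where `e = (m, n)`. -/
noncomputable def linearPowers (e : Fin 2 →₀ ℕ) (a b : Fin 3 → ℂ) : SymPair :=
  (∑ i, a i • X (Sum.inl i)) ^ e 0 * (∑ i, b i • X (Sum.inr i)) ^ e 1

theorem pow_mul_pow_mem_bidegreePart (a b : Fin 3 → ℂ) (m n : ℕ) :
    ((∑ i, a i • X (Sum.inl i)) ^ m * (∑ i, b i • X (Sum.inr i)) ^ n : SymPair) ∈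
      bidegreePart (Finsupp.single 0 m + Finsupp.single 1 n) := by
  have h1 : (∑ i, a i • X (Sum.inl i) : SymPair) ∈ bidegreePart (Finsupp.single 0 1) :=
    Submodule.sum_mem _ fun i _ =>
      Submodule.smul_mem _ _ (isWeightedHomogeneous_X ℂ _ (Sum.inl i))
  have h2 : (∑ i, b i • X (Sum.inr i) : SymPair) ∈ bidegreePart (Finsupp.single 1 1) :=
    Submodule.sum_mem _ fun i _ =>
      Submodule.smul_mem _ _ (isWeightedHomogeneous_X ℂ _ (Sum.inr i))
  have h3 := (IsWeightedHomogeneous.pow h1 m).mul (IsWeightedHomogeneous.pow h2 n)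
  rwa [Finsupp.smul_single, Finsupp.smul_single, smul_eq_mul, smul_eq_mul, mul_one, mul_one] at h3

theorem eq_single_add_single (e : Fin 2 →₀ ℕ) :
    e = Finsupp.single 0 (e 0) + Finsupp.single 1 (e 1) := by
  ext i
  fin_cases i <;> simp

theorem linearPowers_mem (e : Fin 2 →₀ ℕ) (a b : Fin 3 → ℂ) :
    linearPowers e a b ∈ bidegreePart e := by
  have := pow_mul_pow_mem_bidegreePart a b (e 0) (e 1)
  rwa [← eq_single_add_single] at this

theorem sum_inl_of_exponent {e : Fin 2 →₀ ℕ} (d : ExponentsOfDegree pairSlot e) :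
    ∑ i, d.1 (Sum.inl i) = e 0 := by
  conv_rhs => rw [← d.2, weight_single_eq_sum]
  simp

theorem sum_inr_of_exponent {e : Fin 2 →₀ ℕ} (d : ExponentsOfDegree pairSlot e) :
    ∑ i, d.1 (Sum.inr i) = e 1 := by
  conv_rhs => rw [← d.2, weight_single_eq_sum]
  simp

open scoped Nat in
/-- The multinomial expansion of a product of powers of linear forms. -/
theorem prod_factorial_mul_coeff_linearPowers (e : Fin 2 →₀ ℕ) (a b : Fin 3 → ℂ)
    (d : ExponentsOfDegree pairSlot e) :
    ((∏ i, (d.1 i)! : ℕ) : ℂ) * coeff d.1 (linearPowers e a b) =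
      (e 0)! * (e 1)! * ∏ i, Sum.elim a b i ^ d.1 i := by
  have hsum : ∑ i, d.1 i = e 0 + e 1 := by
    rw [Fintype.sum_sum_type, sum_inl_of_exponent, sum_inr_of_exponent]
  -- Both sides are compared with the coefficient of `(∑ aᵢ eᵢ + ∑ bᵢ eᵢ*)ᵐ⁺ⁿ`.
  have h1 := coeff_linearCombination_X_pow_of_fintype (R := ℂ) (Sum.elim a b) d.1 (e 0 + e 1)
  rw [if_pos (by rw [Finsupp.sum_fintype _ _ (by simp), hsum]),
    Finsupp.prod_fintype _ _ (by simp), Fintype.sum_sum_type] at h1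
  simp only [Sum.elim_inl, Sum.elim_inr] at h1
  have h2 : coeff d.1 ((∑ i, a i • X (Sum.inl i) + ∑ i, b i • X (Sum.inr i) : SymPair) ^
      (e 0 + e 1)) = coeff d.1 (linearPowers e a b) * (e 0 + e 1).choose (e 0) := by
    rw [add_pow, coeff_sum, Finset.sum_eq_single (e 0)]
    · rw [Nat.add_sub_cancel_left, ← C_eq_coe_nat, mul_comm, coeff_C_mul, mul_comm]
      rfl
    · intro k _ hk
      rw [← C_eq_coe_nat, mul_comm, coeff_C_mul,
        (pow_mul_pow_mem_bidegreePart a b k _).coeff_eq_zero, mul_zero]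
      rw [d.2]
      intro h
      have := DFunLike.congr_fun h 0
      simp at this
      exact hk this.symm
    · intro h
      exact absurd (Finset.mem_range.mpr (by omega)) h
  have h3 : (∏ i, (d.1 i)!) * d.1.multinomial = (e 0 + e 1)! := by
    rw [← Finsupp.multinomial_of_support_subset (Finset.subset_univ _), Nat.multinomial_spec, hsum]
  have h4 := Nat.add_choose_mul_factorial_mul_factorial (e 0) (e 1)
  rw [← Nat.choose_symm_add] at h4
  have h5 : ((e 0 + e 1).choose (e 0) : ℂ) ≠ 0 :=
    Nat.cast_ne_zero.mpr (Nat.choose_pos (by omega)).ne'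
  rw [h1] at h2
  apply mul_right_cancel₀ h5
  rw [mul_assoc, ← h2]
  have h3' : ((∏ i, (d.1 i)! : ℕ) : ℂ) * d.1.multinomial = (e 0 + e 1)! := by exact_mod_cast h3
  have h4' : ((e 0 + e 1).choose (e 0) : ℂ) * (e 0)! * (e 1)! = (e 0 + e 1)! := by
    exact_mod_cast h4
  linear_combination (∏ i, Sum.elim a b i ^ d.1 i) * (h3' - h4')

open scoped Nat in
/-- The coordinates on a bigraded piece in which the Fischer inner product
`⟨p, r⟩ = ∑ d! (conj p_d) r_d` is the standard one. -/
noncomputable def fischerEquiv (e : Fin 2 →₀ ℕ) :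
    bidegreePart e ≃ₗ[ℂ] EuclideanSpace ℂ (ExponentsOfDegree pairSlot e) :=
  (coeffEquiv pairSlot e).trans
    ((LinearEquiv.piCongrRight fun d => LinearEquiv.smulOfNeZero ℂ ℂ
      ((Real.sqrt (∏ i, (d.1 i)! : ℕ) : ℝ) : ℂ) (by
        rw [Complex.ofReal_ne_zero, Real.sqrt_ne_zero', Nat.cast_pos]
        exact Finset.prod_pos fun i _ => Nat.factorial_pos _)).trans
      (WithLp.linearEquiv 2 ℂ _).symm)

open scoped Nat in
theorem fischerEquiv_apply (e : Fin 2 →₀ ℕ) (p : bidegreePart e)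
    (d : ExponentsOfDegree pairSlot e) :
    fischerEquiv e p d = ((Real.sqrt (∏ i, (d.1 i)! : ℕ) : ℝ) : ℂ) * coeff d.1 p.1 := rfl

open scoped Nat in
/-- The reproducing property of the Fischer inner product: the products of powers of linear
forms represent evaluations. -/
theorem inner_linearPowers (e : Fin 2 →₀ ℕ) (a b : Fin 3 → ℂ) (p : bidegreePart e) :
    inner ℂ (fischerEquiv e ⟨linearPowers e a b, linearPowers_mem e a b⟩) (fischerEquiv e p) =
      (e 0)! * (e 1)! * eval (Sum.elim (fun i => conj (a i)) fun i => conj (b i)) p.1 := by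
  rw [eval_eq_sum_of_mem_multigradedPart, PiLp.inner_apply, Finset.mul_sum]
  refine Finset.sum_congr rfl fun d _ => ?_
  have h := congrArg conj (prod_factorial_mul_coeff_linearPowers e a b d)
  have hs : ((Real.sqrt (∏ i, (d.1 i)! : ℕ) : ℝ) : ℂ) *
      ((Real.sqrt (∏ i, (d.1 i)! : ℕ) : ℝ) : ℂ) =
      ((∏ i, (d.1 i)! : ℕ) : ℂ) := by
    rw [← Complex.ofReal_mul, Real.mul_self_sqrt (Nat.cast_nonneg _), Complex.ofReal_natCast]
  have hc : conj (∏ i, Sum.elim a b i ^ d.1 i) =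
      ∏ i, Sum.elim (fun i => conj (a i)) (fun i => conj (b i)) i ^ d.1 i := by
    rw [map_prod, Fintype.prod_sum_type, Fintype.prod_sum_type]
    simp
  rw [map_mul, map_mul, map_mul, hc, Complex.conj_natCast, Complex.conj_natCast,
    Complex.conj_natCast, ← hs] at h
  rw [fischerEquiv_apply, fischerEquiv_apply, RCLike.inner_apply, map_mul, Complex.conj_ofReal]
  linear_combination (coeff d.1 p.1) * h

/-! ### The simple modules -/

/-- The translates of the highest weight vector are the products of powers of two linear forms given
by the first column of `g` and the last row of `g⁻¹`. -/
theorem symPairRep_highestWeightVector (g : SL3) (e : Fin 2 →₀ ℕ) :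
    symPairRep g (highestWeightVector (e 0) (e 1)) =
      linearPowers e (fun i => g i 0) fun i => (g⁻¹ : SL3) 2 i := by
  change symPairAct g _ = _
  rw [highestWeightVector, map_mul, map_pow, map_pow, symPairAct_X_inl, symPairAct_X_inr]
  simp only [linearPowers, smul_eq_C_mul]

theorem highestWeightVector_eq_monomial (m n : ℕ) :
    highestWeightVector m n =
      monomial (Finsupp.single (Sum.inl 0) m + Finsupp.single (Sum.inr 2) n) 1 := by
  rw [highestWeightVector, X_pow_eq_monomial, X_pow_eq_monomial, monomial_mul, one_mul]

theorem highestWeightVector_ne_zero (m n : ℕ) : highestWeightVector m n ≠ 0 := by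
  rw [highestWeightVector_eq_monomial, Ne, monomial_eq_zero]
  exact one_ne_zero

theorem highestWeightVector_mem (m n : ℕ) :
    highestWeightVector m n ∈ (highestWeightSub m n).toSubmodule :=
  Submodule.subset_span ⟨1, by simp⟩

/-- The exponent of the highest weight vector. -/
noncomputable def highestExponent (e : Fin 2 →₀ ℕ) : ExponentsOfDegree pairSlot e :=
  ⟨Finsupp.single (Sum.inl 0) (e 0) + Finsupp.single (Sum.inr 2) (e 1), by
    rw [map_add, Finsupp.weight_single, Finsupp.weight_single]
    conv_rhs => rw [eq_single_add_single e]
    simp⟩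

/-- The highest exponent is the only one at which the degree `d(e₀) - d(e₂) - d(e₀*) + d(e₂*)` takes
its largest value `m + n`. -/
theorem eq_highestExponent {e : Fin 2 →₀ ℕ} (d : ExponentsOfDegree pairSlot e)
    (h : d.1 (Sum.inl 0) + d.1 (Sum.inr 2) =
      e 0 + e 1 + d.1 (Sum.inl 2) + d.1 (Sum.inr 0)) : d = highestExponent e := by
  have h1 := sum_inl_of_exponent d
  have h2 := sum_inr_of_exponent d
  rw [Fin.sum_univ_three] at h1 h2
  ext (i | i) <;> fin_cases i <;> simp [highestExponent] <;> omega

theorem highestWeightSub_le (e : Fin 2 →₀ ℕ) :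
    (highestWeightSub (e 0) (e 1)).toSubmodule ≤ bidegreePart e := by
  refine Submodule.span_le.mpr ?_
  rintro _ ⟨g, rfl⟩
  simp only [symPairRep_highestWeightVector]
  exact linearPowers_mem _ _ _

instance (m n : ℕ) : FiniteDimensional ℂ (highestWeightSub m n).toSubmodule := by
  have := highestWeightSub_le (Finsupp.single 0 m + Finsupp.single 1 n)
  simp only [Finsupp.add_apply, Finsupp.single_eq_same, ne_eq, one_ne_zero, zero_ne_one,
    not_false_eq_true, Finsupp.single_eq_of_ne, add_zero, zero_add] at this
  exact Submodule.finiteDimensional_of_le this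

/-- The action of `SL₃(ℂ)` on a bigraded piece of `SymPair`. -/
noncomputable def bidegreeRep (e : Fin 2 →₀ ℕ) : Representation ℂ SL3 (bidegreePart e) :=
  Subrepresentation.toRepresentation (ρ := symPairRep)
    ⟨bidegreePart e, fun _ _ => pairAct_mem_bidegreePart _ _ e⟩

theorem coe_bidegreeRep (e : Fin 2 →₀ ℕ) (g : SL3) (p : bidegreePart e) :
    (bidegreeRep e g p : SymPair) = symPairAct g p := rfl

/-- The module generated by the highest weight vector, inside its bigraded piece. -/
noncomputable def highestPart (e : Fin 2 →₀ ℕ) : Subrepresentation (bidegreeRep e) where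
  toSubmodule := (highestWeightSub (e 0) (e 1)).toSubmodule.comap (bidegreePart e).subtype
  apply_mem_toSubmodule g _ hp := (highestWeightSub (e 0) (e 1)).apply_mem_toSubmodule g hp

/-- The multiples of the contraction inside a bigraded piece. -/
noncomputable def contractionPart (e : Fin 2 →₀ ℕ) : Subrepresentation (bidegreeRep e) where
  toSubmodule := ((Ideal.span {contraction}).restrictScalars ℂ).comap (bidegreePart e).subtype
  apply_mem_toSubmodule g p hp := by
    obtain ⟨r, hr⟩ := Ideal.mem_span_singleton.mp hp
    refine Ideal.mem_span_singleton.mpr ⟨symPairAct g r, ?_⟩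
    rw [Submodule.subtype_apply] at hr ⊢
    rw [coe_bidegreeRep, hr, map_mul, symPairAct_contraction]

theorem mem_contractionPart {e : Fin 2 →₀ ℕ} {p : bidegreePart e} :
    p ∈ (contractionPart e).toSubmodule ↔ contraction ∣ p.1 :=
  Ideal.mem_span_singleton

/-- The multiples of the contraction are the equations of the cone. -/
theorem contraction_dvd_iff_vanishesOnCone {e : Fin 2 →₀ ℕ} (p : bidegreePart e) :
    contraction ∣ p.1 ↔ VanishesOnCone p.1 := by
  refine ⟨?_, contraction_dvd_of_vanishesOnCone p.2⟩
  rintro ⟨r, hr⟩ a b _ _ hab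
  rw [hr, map_mul, eval_contraction]
  simp [hab]

/-- A bihomogeneous polynomial is orthogonal to the module generated by the highest weight vector
if and only if it vanishes on the cone. -/
theorem vanishesOnCone_iff_inner_eq_zero {e : Fin 2 →₀ ℕ} (p : bidegreePart e) :
    VanishesOnCone p.1 ↔ ∀ r ∈ (highestPart e).toSubmodule,
      inner ℂ (fischerEquiv e r) (fischerEquiv e p) = 0 := by
  constructor
  · intro h r hr
    obtain ⟨r, hr'⟩ := r
    have hr2 : r ∈ (highestWeightSub (e 0) (e 1)).toSubmodule := hr
    clear hr
    induction hr2 using Submodule.span_induction with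
    | mem x hx =>
      obtain ⟨g, rfl⟩ := hx
      have hg : (g⁻¹ : SL3).1 * g.1 = 1 := by
        rw [← Matrix.SpecialLinearGroup.coe_mul, inv_mul_cancel,
          Matrix.SpecialLinearGroup.coe_one]
      have hg' : g.1 * (g⁻¹ : SL3).1 = 1 := by
        rw [← Matrix.SpecialLinearGroup.coe_mul, mul_inv_cancel,
          Matrix.SpecialLinearGroup.coe_one]
      have h20 := congrFun (congrFun hg 2) 0
      have h22 := congrFun (congrFun hg 2) 2
      have h00 := congrFun (congrFun hg 0) 0
      rw [Matrix.mul_apply] at h20 h22 h00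
      simp only [symPairRep_highestWeightVector]
      rw [inner_linearPowers, h, mul_zero]
      · intro h0
        have h0' : ∀ i, g.1 i 0 = 0 := fun i => by
          have := congrFun h0 i
          simpa only [Pi.zero_apply, map_eq_zero] using this
        simp [h0'] at h00
      · intro h0
        have h0' : ∀ i, (g⁻¹ : SL3).1 2 i = 0 := fun i => by
          have := congrFun h0 i
          simpa only [Pi.zero_apply, map_eq_zero] using this
        simp [h0'] at h22
      · have := congrArg conj h20
        simp only [map_sum, map_mul] at this
        simp only [mul_comm (conj (g.1 _ 0))]
        rw [this]
        simp
    | zero =>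
      rw [show (⟨0, hr'⟩ : bidegreePart e) = 0 from rfl, map_zero, inner_zero_left]
    | add x y hx hy ihx ihy =>
      have hx' := highestWeightSub_le e hx
      have hy' := highestWeightSub_le e hy
      rw [show (⟨x + y, hr'⟩ : bidegreePart e) = ⟨x, hx'⟩ + ⟨y, hy'⟩ from rfl, map_add,
        inner_add_left, ihx, ihy, add_zero]
    | smul c x hx ihx =>
      have hx' := highestWeightSub_le e hx
      rw [show (⟨c • x, hr'⟩ : bidegreePart e) = c • ⟨x, hx'⟩ from rfl, map_smul,
        inner_smul_left, ihx, mul_zero]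
  · intro h a b ha hb hab
    obtain ⟨g, hga, hgb⟩ := exists_SL3_of_mem_cone (a := fun i => conj (a i))
      (b := fun i => conj (b i)) (fun h0 => ha (funext fun i => by simpa using congrFun h0 i))
      (fun h0 => hb (funext fun i => by simpa using congrFun h0 i))
      (by simpa using congrArg conj hab)
    have h1 := h ⟨linearPowers e (fun i => conj (a i)) fun i => conj (b i), linearPowers_mem _ _ _⟩
      (Submodule.subset_span ⟨g, by
        simp only [symPairRep_highestWeightVector, hga, hgb]; rfl⟩)
    rw [inner_linearPowers] at h1
    simp only [Complex.conj_conj] at h1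
    have hf : ∀ n : ℕ, (n.factorial : ℂ) ≠ 0 := fun n => Nat.cast_ne_zero.mpr n.factorial_ne_zero
    exact (mul_eq_zero.mp h1).resolve_left (mul_ne_zero (hf _) (hf _))

/-- The bigraded piece is the direct sum of the module generated by the highest weight vector and
of the multiples of the contraction: the second summand is the orthogonal complement of the first
one. -/
theorem isCompl_highestPart_contractionPart (e : Fin 2 →₀ ℕ) :
    IsCompl (highestPart e).toSubmodule (contractionPart e).toSubmodule := by
  let E := (highestPart e).toSubmodule.map (fischerEquiv e).toLinearMap
  have h : (contractionPart e).toSubmodule = Eᗮ.comap (fischerEquiv e).toLinearMap := by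
    ext p
    rw [mem_contractionPart, contraction_dvd_iff_vanishesOnCone, vanishesOnCone_iff_inner_eq_zero,
      Submodule.mem_comap, Submodule.mem_orthogonal]
    exact ⟨fun h u ⟨r, hr, hu⟩ => hu ▸ h r hr, fun h r hr => h _ ⟨r, hr, rfl⟩⟩
  have h' : (highestPart e).toSubmodule = E.comap (fischerEquiv e).toLinearMap :=
    (Submodule.comap_map_eq_of_injective (fischerEquiv e).injective _).symm
  rw [h, h']
  exact (Submodule.isCompl_orthogonal (K := E)).map
    (Submodule.orderIsoMapComap (fischerEquiv e)).symm

/-- A nonzero vector of the module generated by the highest weight vector has a translate with a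
nonzero coefficient at the highest weight vector. -/
theorem exists_coeff_symPairAct_ne_zero {e : Fin 2 →₀ ℕ} {p : SymPair}
    (hp : p ∈ (highestWeightSub (e 0) (e 1)).toSubmodule) (hp0 : p ≠ 0) :
    ∃ g : SL3, coeff (highestExponent e).1 (symPairAct g p) ≠ 0 := by
  have hpe := highestWeightSub_le e hp
  have h : ¬ VanishesOnCone p := by
    intro h
    rw [vanishesOnCone_iff_inner_eq_zero ⟨p, hpe⟩] at h
    have := h ⟨p, hpe⟩ hp
    rw [inner_self_eq_zero, LinearEquiv.map_eq_zero_iff] at this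
    exact hp0 (congrArg Subtype.val this)
  simp only [VanishesOnCone, not_forall] at h
  obtain ⟨a, b, ha, hb, hab, hne⟩ := h
  obtain ⟨g, hga, hgb⟩ := exists_SL3_of_mem_cone ha hb hab
  -- The coefficient at the highest weight vector is the value at `(e₀, e₂*)`, and the transpose
  -- of `g` moves this point to `(a, b)`.
  let k : SL3 := ⟨g.1ᵀ, by rw [Matrix.det_transpose]; exact g.2⟩
  have hk : ∀ i, (k⁻¹ : SL3) i 2 = b i := fun i => by
    rw [← hgb, Matrix.SpecialLinearGroup.coe_inv, Matrix.SpecialLinearGroup.coe_inv]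
    exact congrFun (congrFun (Matrix.adjugate_transpose g.1).symm i) 2
  refine ⟨k, fun h0 => hne ?_⟩
  have h1 : eval (Sum.elim (Pi.single 0 1) (Pi.single 2 1)) (symPairAct k p) =
      eval (Sum.elim a b) p := by
    rw [symPairAct, eval_aeval_eq_eval]
    congr 2
    ext (i | i)
    · simp [Pi.single_apply, k, hga]
    · simp only [Sum.elim_inr, map_sum, map_mul, eval_C, eval_X]
      rw [Finset.sum_eq_single 2]
      · rw [hk]
        simp
      · intro j _ hj
        simp [hj]
      · simp
  rw [← h1, eval_eq_sum_of_mem_multigradedPart pairSlot e _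
    ⟨symPairAct k p, pairAct_mem_bidegreePart _ _ e hpe⟩]
  refine Finset.sum_eq_zero fun d _ => ?_
  by_cases hd : d = highestExponent e
  · subst hd
    rw [h0, zero_mul]
  · have hd' : ∃ i : Fin 3 ⊕ Fin 3, i ≠ Sum.inl 0 ∧ i ≠ Sum.inr 2 ∧ d.1 i ≠ 0 := by
      by_contra! hcon
      have h1 := sum_inl_of_exponent d
      have h2 := sum_inr_of_exponent d
      rw [Fin.sum_univ_three] at h1 h2
      have h3 := hcon (Sum.inl 1) (by simp) (by simp)
      have h4 := hcon (Sum.inl 2) (by simp) (by simp)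
      have h5 := hcon (Sum.inr 0) (by simp) (by simp)
      have h6 := hcon (Sum.inr 1) (by simp) (by simp)
      exact hd (eq_highestExponent d (by omega))
    obtain ⟨i, hi1, hi2, hi3⟩ := hd'
    rw [Finset.prod_eq_zero (Finset.mem_univ i), mul_zero]
    rcases i with i | i
    · rw [Sum.elim_inl, Pi.single_eq_of_ne (fun h => hi1 (by rw [h])), zero_pow hi3]
    · rw [Sum.elim_inr, Pi.single_eq_of_ne (fun h => hi2 (by rw [h])), zero_pow hi3]

/-- The element `diag(2, 1, 1/2)` of the torus. -/
noncomputable def torusElement : SL3 :=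
  ⟨Matrix.diagonal ![2, 1, 2⁻¹], by simp [Matrix.det_diagonal, Fin.prod_univ_three]⟩

/-- The eigenvalue of `torusElement` on a monomial. -/
noncomputable def torusEigenvalue (d : Fin 3 ⊕ Fin 3 →₀ ℕ) : ℂ :=
  ∏ i, (Sum.elim ![2, 1, 2⁻¹] ![2⁻¹, 1, 2] i : ℂ) ^ d i

theorem coeff_symPairAct_torusElement (p : SymPair) (d : Fin 3 ⊕ Fin 3 →₀ ℕ) :
    coeff d (symPairAct torusElement p) = torusEigenvalue d * coeff d p := by
  have h : ((torusElement⁻¹ : SL3) : Matrix (Fin 3) (Fin 3) ℂ) = Matrix.diagonal ![2⁻¹, 1, 2] := by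
    rw [Matrix.SpecialLinearGroup.coe_inv, torusElement, Matrix.adjugate_fin_three]
    ext i j
    fin_cases i <;> fin_cases j <;> simp
  rw [symPairAct_eq_pairAct, h]
  change coeff d (pairAct (Matrix.diagonal _) _ p) = _
  rw [pairAct_diagonal, coeff_aeval_C_mul_X]
  rfl

/-- The largest eigenvalue of `torusElement` on a bigraded piece only occurs for the highest weight
vector. -/
theorem torusEigenvalue_ne {e : Fin 2 →₀ ℕ} (d : ExponentsOfDegree pairSlot e)
    (hd : d ≠ highestExponent e) :
    torusEigenvalue (highestExponent e).1 ≠ torusEigenvalue d.1 := by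
  intro h
  -- Both sides are multiplied by the denominators, to compare powers of `2` in `ℕ`.
  have h1 : ∀ d : Fin 3 ⊕ Fin 3 →₀ ℕ, torusEigenvalue d * 2 ^ (d (Sum.inl 2) + d (Sum.inr 0)) =
      2 ^ (d (Sum.inl 0) + d (Sum.inr 2)) := fun d => by
    rw [torusEigenvalue, Fintype.prod_sum_type, Fin.prod_univ_three, Fin.prod_univ_three]
    simp [pow_add]
    field_simp
  have h2 := h1 (highestExponent e).1
  have h3 := h1 d.1
  rw [h] at h2
  simp only [highestExponent, Finsupp.add_apply] at h2
  simp at h2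
  rw [h2] at h3
  have h4 : (2 : ℕ) ^ (e 0 + e 1 + (d.1 (Sum.inl 2) + d.1 (Sum.inr 0))) =
      2 ^ (d.1 (Sum.inl 0) + d.1 (Sum.inr 2)) := by
    rw [pow_add]
    exact_mod_cast h3
  have h5 := Nat.pow_right_injective le_rfl h4
  exact hd (eq_highestExponent d (by omega))

/-- An invariant subspace that contains a vector of bidegree `e` with a nonzero coefficient at the
highest weight vector contains the highest weight vector: the other coefficients are killed by a
polynomial in `torusElement`. -/
theorem highestWeightVector_mem_of_coeff_ne_zero {e : Fin 2 →₀ ℕ} (U : Submodule ℂ SymPair)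
    (hU : ∀ g, ∀ p ∈ U, symPairAct g p ∈ U) {p : SymPair} (hp : p ∈ U) (hpe : p ∈ bidegreePart e)
    (h : coeff (highestExponent e).1 p ≠ 0) : highestWeightVector (e 0) (e 1) ∈ U := by
  classical
  have key : ∀ S : Finset (ExponentsOfDegree pairSlot e), ∃ f ∈ U, f ∈ bidegreePart e ∧
      ∀ d, coeff d f =
        (∏ d' ∈ S, (torusEigenvalue d - torusEigenvalue d'.1)) * coeff d p := by
    intro S
    induction S using Finset.induction_on with
    | empty => exact ⟨p, hp, hpe, by simp⟩
    | insert d' S hd' ih =>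
      obtain ⟨f, hf, hfe, hfc⟩ := ih
      refine ⟨symPairAct torusElement f - torusEigenvalue d'.1 • f,
        U.sub_mem (hU _ _ hf) (U.smul_mem _ hf), Submodule.sub_mem _
          (pairAct_mem_bidegreePart _ _ e hfe) (Submodule.smul_mem _ _ hfe), fun d => ?_⟩
      rw [coeff_sub, coeff_smul, coeff_symPairAct_torusElement, hfc, Finset.prod_insert hd',
        smul_eq_mul]
      ring
  obtain ⟨f, hf, hfe, hfc⟩ := key (Finset.univ.erase (highestExponent e))
  have hc : coeff (highestExponent e).1 f ≠ 0 := by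
    rw [hfc]
    refine mul_ne_zero (Finset.prod_ne_zero_iff.mpr fun d hd => ?_) h
    exact sub_ne_zero.mpr (torusEigenvalue_ne d (Finset.ne_of_mem_erase hd))
  have hfm : f = coeff (highestExponent e).1 f • highestWeightVector (e 0) (e 1) := by
    ext d
    rw [coeff_smul, highestWeightVector_eq_monomial, coeff_monomial]
    change _ = _ • if (highestExponent e).1 = d then (1 : ℂ) else 0
    split_ifs with hd
    · rw [← hd, smul_eq_mul, mul_one]
    · rw [smul_zero]
      by_cases hde : Finsupp.weight (fun i => Finsupp.single (pairSlot i) 1) d = e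
      · rw [hfc, Finset.prod_eq_zero (i := ⟨d, hde⟩), zero_mul]
        · exact Finset.mem_erase.mpr
            ⟨fun h => hd (congrArg Subtype.val h).symm, Finset.mem_univ _⟩
        · exact sub_self _
      · exact hfe.coeff_eq_zero d hde
  exact (Submodule.smul_mem_iff U hc).mp (hfm ▸ hf)

/-- A nonzero invariant subspace contains the highest weight vector, hence all its translates. -/
theorem piRep_isIrreducible (m n : ℕ) : (piRep m n).IsIrreducible := by
  obtain ⟨e, rfl, rfl⟩ : ∃ e : Fin 2 →₀ ℕ, e 0 = m ∧ e 1 = n :=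
    ⟨Finsupp.single 0 m + Finsupp.single 1 n, by simp, by simp⟩
  have hnt : Nontrivial (Subrepresentation (piRep (e 0) (e 1))) := by
    refine ⟨⊥, ⊤, fun h => highestWeightVector_ne_zero (e 0) (e 1) ?_⟩
    have h' : (⊥ : Submodule ℂ (highestWeightSub (e 0) (e 1)).toSubmodule) = ⊤ :=
      congrArg Subrepresentation.toSubmodule h
    have := (Submodule.mem_bot ℂ).mp (h'.symm ▸ Submodule.mem_top :
      (⟨_, highestWeightVector_mem (e 0) (e 1)⟩ : (highestWeightSub (e 0) (e 1)).toSubmodule) ∈ ⊥)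
    exact congrArg Subtype.val this
  refine ⟨fun S => or_iff_not_imp_left.mpr fun hS => ?_⟩
  have hS' : S.toSubmodule ≠ ⊥ := fun h => hS (Subrepresentation.toSubmodule_injective h)
  obtain ⟨p, hp, hp0⟩ := S.toSubmodule.ne_bot_iff.mp hS'
  let U := S.toSubmodule.map (highestWeightSub (e 0) (e 1)).toSubmodule.subtype
  have hU : ∀ g, ∀ p ∈ U, symPairAct g p ∈ U := by
    rintro g _ ⟨q, hq, rfl⟩
    exact ⟨piRep (e 0) (e 1) g q, S.apply_mem_toSubmodule g hq, rfl⟩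
  obtain ⟨g, hg⟩ := exists_coeff_symPairAct_ne_zero p.2 fun h => hp0 (Subtype.ext h)
  have hv := highestWeightVector_mem_of_coeff_ne_zero U hU (hU g _ ⟨p, hp, rfl⟩)
    (pairAct_mem_bidegreePart _ _ e (highestWeightSub_le e p.2)) hg
  have hle : (highestWeightSub (e 0) (e 1)).toSubmodule ≤ U := by
    refine Submodule.span_le.mpr ?_
    rintro _ ⟨g, rfl⟩
    exact hU g _ hv
  apply Subrepresentation.toSubmodule_injective
  change S.toSubmodule = ⊤
  refine eq_top_iff.mpr fun q _ => ?_
  obtain ⟨q', hq', h⟩ := hle q.2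
  rwa [Subtype.ext h] at hq'

theorem piRep_isSimpleOfHighestWeight (m n : ℕ) : IsSimpleOfHighestWeight m n (piRep m n) := by
  refine ⟨inferInstance, piRep_isIrreducible m n,
    ⟨_, highestWeightVector_mem m n⟩, fun h =>
      highestWeightVector_ne_zero m n (congrArg Subtype.val h), fun b hb => Subtype.ext ?_⟩
  change symPairAct b (highestWeightVector m n) =
    (b 0 0 ^ m * (b 0 0 * b 1 1) ^ n) • highestWeightVector m n
  have h10 : b 1 0 = 0 := hb (show (0 : Fin 3) < 1 by decide)
  have h20 : b 2 0 = 0 := hb (show (0 : Fin 3) < 2 by decide)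
  have h21 : b 2 1 = 0 := hb (show (1 : Fin 3) < 2 by decide)
  have hinv : ∀ j, (b⁻¹ : SL3) 2 j = if j = 2 then b 0 0 * b 1 1 else 0 := by
    intro j
    rw [Matrix.SpecialLinearGroup.coe_inv, Matrix.adjugate_fin_three]
    fin_cases j <;> simp [h10, h20, h21]
  rw [highestWeightVector, map_mul, map_pow, map_pow, symPairAct_X_inl, symPairAct_X_inr,
    Fin.sum_univ_three, Fin.sum_univ_three, hinv, hinv, hinv, h10, h20]
  simp only [map_zero, zero_mul, add_zero, zero_add, if_true, Fin.reduceEq, if_false, mul_pow,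
    smul_eq_C_mul, map_mul, map_pow]
  ring

/-! ### The characters of the simple modules -/

/-- Multiplication by the contraction, as a map onto its multiples in a bigraded piece. -/
noncomputable def mulContraction (e : Fin 2 →₀ ℕ) (he : bidegreeOne ≤ e) :
    bidegreePart (e - bidegreeOne) →ₗ[ℂ] (contractionPart e).toSubmodule :=
  ((LinearMap.mulLeft ℂ contraction).restrict (q := bidegreePart e) fun r hr => by
    have := IsWeightedHomogeneous.mul contraction_mem hr
    rwa [add_tsub_cancel_of_le he] at this).codRestrict _ fun r =>
      mem_contractionPart.mpr ⟨r.1, rfl⟩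

theorem coe_mulContraction (e : Fin 2 →₀ ℕ) (he : bidegreeOne ≤ e)
    (r : bidegreePart (e - bidegreeOne)) :
    ((mulContraction e he r : bidegreePart e) : SymPair) = contraction * r := rfl

/-- The multiples of the contraction in a bigraded piece form a shifted bigraded piece. -/
noncomputable def contractionPartEquiv (e : Fin 2 →₀ ℕ) (he : bidegreeOne ≤ e) :
    (bidegreeRep (e - bidegreeOne)).Equiv (contractionPart e).toRepresentation :=
  Representation.Equiv.mk (LinearEquiv.ofBijective (mulContraction e he) (by
    constructor
    · intro r r' h
      have := congrArg
        (fun p : (contractionPart e).toSubmodule => ((p : bidegreePart e) : SymPair)) h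
      simp only [coe_mulContraction] at this
      exact Subtype.ext (mul_left_cancel₀ contraction_ne_zero this)
    · intro p
      obtain ⟨r, hr, h⟩ := exists_eq_contraction_mul p.1.2 (mem_contractionPart.mp p.2) he
      exact ⟨⟨r, hr⟩, Subtype.ext (Subtype.ext h.symm)⟩)) fun g => by
    ext r : 3
    change contraction * symPairAct g r = symPairAct g (contraction * r)
    rw [map_mul, symPairAct_contraction]

/-- The module generated by the highest weight vector, inside and outside its bigraded piece. -/
noncomputable def highestPartEquiv (e : Fin 2 →₀ ℕ) :
    (highestPart e).toRepresentation.Equiv (piRep (e 0) (e 1)) :=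
  Representation.Equiv.mk (Submodule.comapSubtypeEquivOfLe (highestWeightSub_le e)) fun g => by
    ext r
    rfl

/-- The character of a simple module is the difference of the characters of two bigraded
pieces. -/
theorem character_piRep (e : Fin 2 →₀ ℕ) (g : SL3) :
    (piRep (e 0) (e 1)).character g = (bidegreeRep e).character g -
      if bidegreeOne ≤ e then (bidegreeRep (e - bidegreeOne)).character g else 0 := by
  have h : Representation.character (V := (highestPart e).toSubmodule)
      (highestPart e).toRepresentation = (piRep (e 0) (e 1)).character :=
    Representation.char_iso (V := (highestPart e).toSubmodule) (highestPartEquiv e)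
  rw [← h, Representation.character_eq_add_of_isCompl _ _ _ (isCompl_highestPart_contractionPart e)]
  split_ifs with he
  · have h' : (bidegreeRep (e - bidegreeOne)).character = Representation.character
        (V := (contractionPart e).toSubmodule) (contractionPart e).toRepresentation :=
      Representation.char_iso (W := (contractionPart e).toSubmodule) (contractionPartEquiv e he)
    rw [h', add_sub_cancel_right]
  · have h : Subsingleton (contractionPart e).toSubmodule := by
      refine subsingleton_of_forall_eq 0 fun p => Subtype.ext (Subtype.ext ?_)
      exact eq_zero_of_contraction_dvd p.1.2 (mem_contractionPart.mp p.2) he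
    have h0 : Representation.character (k := ℂ) (V := (contractionPart e).toSubmodule)
        (contractionPart e).toRepresentation g = 0 := by
      rw [Representation.character, Subsingleton.elim ((contractionPart e).toRepresentation g) 0,
        map_zero]
    rw [h0, add_zero, sub_zero]

/-- The generating series of the values at `g` of the characters of the simple modules. -/
noncomputable def characterSeries (g : SL3) : MvPowerSeries (Fin 2) ℂ :=
  fun e => (piRep (e 0) (e 1)).character g

theorem coeff_characterSeries (g : SL3) (e : Fin 2 →₀ ℕ) :
    MvPowerSeries.coeff e (characterSeries g) = (piRep (e 0) (e 1)).character g := rfl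

theorem character_natRep (g : SL3) :
    natRep.character g = (g : Matrix (Fin 3) (Fin 3) ℂ).trace :=
  Matrix.trace_toLin'_eq _

/-- The product formula for the generating series of the characters of the simple modules, at an
element of finite order. -/
theorem charpoly_mul_characterSeries (g : SL3) (hg : IsOfFinOrder g)
    (t u : MvPowerSeries (Fin 2) ℂ) (ht : t = MvPowerSeries.X 0) (hu : u = MvPowerSeries.X 1) :
    (1 - t * MvPowerSeries.C (natRep.character g) +
        t ^ 2 * MvPowerSeries.C (natRep.character g⁻¹) - t ^ 3) *
      (1 - u * MvPowerSeries.C (natRep.character g⁻¹) +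
        u ^ 2 * MvPowerSeries.C (natRep.character g) - u ^ 3) * characterSeries g = 1 - t * u := by
  obtain ⟨c, hc, hx, hy, htr⟩ := exists_eigenvalues_of_isOfFinOrder g hg
  have h : characterSeries g = (1 - t * u) * monomialSumSeries pairSlot (Sum.elim c c⁻¹) := by
    have htu : t * u = MvPowerSeries.monomial bidegreeOne 1 := by
      rw [ht, hu, MvPowerSeries.X, MvPowerSeries.X, MvPowerSeries.monomial_mul_monomial, one_mul,
        bidegreeOne]
    ext e
    rw [sub_mul, one_mul, htu, map_sub, MvPowerSeries.coeff_monomial_mul, coeff_characterSeries,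
      character_piRep, one_mul, ← htr, ← htr]
    rfl
  have := charpoly_mul_monomialSumSeries c hc _ _ (character_natRep g ▸ hx)
    (character_natRep g⁻¹ ▸ hy) t u ht hu
  rw [h]
  linear_combination (1 - t * u) * this

/-! ### The McKay matrices -/

/-- The values at `g⁻¹` of the irreducible characters form an eigenvector of the matrix of the
tensor product with a representation `ρ`, with eigenvalue the value at `g` of the character
of `ρ`. -/
theorem IsIrrepSystem.sum_repMultiplicity_tprod_mul_character {G : Type*} [Group G] [Finite G]
    {l : ℕ} {W : Fin (l + 1) → Type*} [∀ i, AddCommGroup (W i)] [∀ i, Module ℂ (W i)]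
    {γ : ∀ i, Representation ℂ G (W i)} (hγ : IsIrrepSystem γ) {V : Type*} [AddCommGroup V]
    [Module ℂ V] [FiniteDimensional ℂ V] (ρ : Representation ℂ G V) (i : Fin (l + 1)) (g : G) :
    ∑ j, (repMultiplicity (γ i) ((γ j).tprod ρ) : ℂ) * (γ j).character g⁻¹ =
      ρ.character g * (γ i).character g⁻¹ := by
  have := hγ.finiteDimensional
  have := Fintype.ofFinite G
  have h : ∀ j, (repMultiplicity (γ i) ((γ j).tprod ρ) : ℂ) =
      repMultiplicity (γ j) ((γ i).tprod ρ.dual) := fun j => by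
    -- The sum over the group is reindexed by `x ↦ x⁻¹`.
    rw [repMultiplicity_eq_sum, repMultiplicity_eq_sum, ← Equiv.sum_comp (Equiv.inv G)]
    simp only [Equiv.inv_apply, Representation.char_tensor, Pi.mul_apply,
      Representation.char_dual, inv_inv]
    congr 1
    exact Finset.sum_congr rfl fun x _ => by ring
  simp only [h]
  rw [← hγ.character_eq_sum, Representation.char_tensor, Pi.mul_apply, Representation.char_dual,
    inv_inv, mul_comm]

theorem isOfFinOrder_coe_of_finite {G : Type*} [Group G] {H : Subgroup G} [Finite H] (h : H) :
    IsOfFinOrder (h : G) :=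
  H.subtype.isOfFinOrder (isOfFinOrder_of_finite h)

section McKay

variable {Γ : Subgroup SL3} {l : ℕ} {W : Fin (l + 1) → Type*}
  [∀ i, AddCommGroup (W i)] [∀ i, Module ℂ (W i)] {γ : ∀ i, Representation ℂ Γ (W i)}

/-- The vector of the values at `g⁻¹` of the irreducible characters. -/
noncomputable def characterVec (γ : ∀ i, Representation ℂ Γ (W i)) (g : Γ) :
    Fin (l + 1) → MvPowerSeries (Fin 2) ℂ :=
  fun i => MvPowerSeries.C ((γ i).character g⁻¹)

theorem seriesMatrix_mckayOne_mulVec [Finite Γ] (hγ : IsIrrepSystem γ) (g : Γ) :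
    seriesMatrix (mckayOne γ) *ᵥ characterVec γ g =
      (MvPowerSeries.C (natRep.character (g : SL3)) : MvPowerSeries (Fin 2) ℂ) •
        characterVec γ g := by
  ext1 i
  have := congrArg (MvPowerSeries.C (σ := Fin 2))
    (hγ.sum_repMultiplicity_tprod_mul_character (natRepOf Γ) i g)
  rw [map_sum, map_mul] at this
  simp only [map_mul, map_natCast] at this
  exact this

theorem seriesMatrix_mckayTwo_mulVec [Finite Γ] (hγ : IsIrrepSystem γ) (g : Γ) :
    seriesMatrix (mckayTwo γ) *ᵥ characterVec γ g =
      (MvPowerSeries.C (natRep.character (g : SL3)⁻¹) : MvPowerSeries (Fin 2) ℂ) •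
        characterVec γ g := by
  ext1 i
  have := congrArg (MvPowerSeries.C (σ := Fin 2))
    (hγ.sum_repMultiplicity_tprod_mul_character (natRepOf Γ).dual i g)
  rw [map_sum, map_mul, Representation.char_dual] at this
  simp only [map_mul, map_natCast] at this
  exact this

/-- The scalar products of characters, collected over all `m` and `n`: `P_Γ` is the average of the
vectors of character values, weighted by the series of the characters of the simple modules. -/
theorem genSeries_eq_sum [Fintype Γ] (hγ : IsIrrepSystem γ) :
    genSeries γ = ∑ g : Γ, (MvPowerSeries.C (Nat.card Γ : ℂ)⁻¹ * characterSeries (g : SL3)) •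
      characterVec γ g := by
  have := hγ.finiteDimensional
  ext i e
  rw [Finset.sum_apply, map_sum]
  change multVec γ (e 0) (e 1) i = _
  rw [multVec, repMultiplicity_eq_sum, Finset.mul_sum]
  refine Finset.sum_congr rfl fun g _ => ?_
  rw [Pi.smul_apply, smul_eq_mul, characterVec, MvPowerSeries.coeff_mul_C,
    MvPowerSeries.coeff_C_mul, coeff_characterSeries, mul_assoc]
  rfl

theorem character_piRep_zero (g : SL3) (hg : IsOfFinOrder g) : (piRep 0 0).character g = 1 := by
  have h := congrArg MvPowerSeries.constantCoeff
    (charpoly_mul_characterSeries g hg _ _ rfl rfl)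
  have h0 : MvPowerSeries.constantCoeff (characterSeries g) = (piRep 0 0).character g := rfl
  rw [map_mul, h0] at h
  simpa using h

theorem multVec_zero_zero_eq_sum [Fintype Γ] (hγ : IsIrrepSystem γ) (i : Fin (l + 1)) :
    multVec γ 0 0 i = (Nat.card Γ : ℂ)⁻¹ * ∑ g : Γ, (γ i).character g⁻¹ := by
  have := hγ.finiteDimensional
  rw [multVec, repMultiplicity_eq_sum]
  congr 1
  refine Finset.sum_congr rfl fun g _ => ?_
  have h : Representation.character ((piRep 0 0).comp Γ.subtype) g = 1 :=
    character_piRep_zero _ (isOfFinOrder_coe_of_finite g)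
  rw [h, one_mul]

theorem multVec_zero_zero [Finite Γ] (hγ : IsIrrepSystem γ) : multVec γ 0 0 = Pi.single 0 1 := by
  have := hγ.finiteDimensional
  have := Fintype.ofFinite Γ
  ext i
  have h0 : ∀ g, (γ 0).character g = 1 := fun g => by
    obtain ⟨φ⟩ := hγ.zero_trivial
    rw [Representation.char_iso φ, Representation.character,
      show Representation.trivial ℂ Γ ℂ g = 1 from rfl, LinearMap.trace_one,
      Module.finrank_self, Nat.cast_one]
  have h1 := hγ.repMultiplicity_eq i 0
  rw [repMultiplicity_eq_sum] at h1
  simp only [h0, one_mul] at h1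
  rw [multVec_zero_zero_eq_sum hγ, h1, Pi.single_apply]

end McKay

theorem mainTheorem1 (Γ : Subgroup SL3) [Finite Γ] {l : ℕ} {W : Fin (l + 1) → Type*}
    [∀ i, AddCommGroup (W i)] [∀ i, Module ℂ (W i)]
    (γ : ∀ i, Representation ℂ Γ (W i)) (hγ : IsIrrepSystem γ)
    (t u : MvPowerSeries (Fin 2) ℂ) (ht : t = MvPowerSeries.X 0) (hu : u = MvPowerSeries.X 1)
    (A₁ A₂ : Matrix (Fin (l + 1)) (Fin (l + 1)) (MvPowerSeries (Fin 2) ℂ))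
    (hA₁ : A₁ = seriesMatrix (mckayOne γ)) (hA₂ : A₂ = seriesMatrix (mckayTwo γ)) :
    (∀ m n : ℕ, IsSimpleOfHighestWeight m n (piRep m n)) ∧
    multVec γ 0 0 = Pi.single 0 1 ∧
    ((1 - t • A₁ + t ^ 2 • A₂ - t ^ 3 • 1) * (1 - u • A₂ + u ^ 2 • A₁ - u ^ 3 • 1)) *ᵥ
        genSeries γ =
      (1 - t * u) • fun i => MvPowerSeries.C (multVec γ 0 0 i) := by
  refine ⟨piRep_isSimpleOfHighestWeight, multVec_zero_zero hγ, ?_⟩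
  have := Fintype.ofFinite Γ
  have h1 := seriesMatrix_mckayOne_mulVec hγ
  have h2 := seriesMatrix_mckayTwo_mulVec hγ
  rw [← hA₁] at h1
  rw [← hA₂] at h2
  have key : ∀ g : Γ, ((1 - t • A₁ + t ^ 2 • A₂ - t ^ 3 • 1) *
      (1 - u • A₂ + u ^ 2 • A₁ - u ^ 3 • 1)) *ᵥ
        ((MvPowerSeries.C (Nat.card Γ : ℂ)⁻¹ * characterSeries (g : SL3)) • characterVec γ g) =
      (1 - t * u) • (MvPowerSeries.C (Nat.card Γ : ℂ)⁻¹ : MvPowerSeries (Fin 2) ℂ) •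
        characterVec γ g := fun g => by
    have h3 := charpoly_mul_characterSeries (g : SL3)
      (isOfFinOrder_coe_of_finite g) t u ht hu
    rw [Matrix.mulVec_smul, ← Matrix.mulVec_mulVec, ← h3]
    simp only [Matrix.sub_mulVec, Matrix.add_mulVec, Matrix.smul_mulVec, Matrix.one_mulVec, h1, h2,
      Matrix.mulVec_sub, Matrix.mulVec_add, Matrix.mulVec_smul]
    ext1 i
    simp only [Pi.smul_apply, Pi.sub_apply, Pi.add_apply, smul_eq_mul]
    ring
  rw [genSeries_eq_sum hγ, Matrix.mulVec_sum, Finset.sum_congr rfl fun g _ => key g,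
    ← Finset.smul_sum]
  congr 1
  ext1 i
  rw [multVec_zero_zero_eq_sum hγ, map_mul, map_sum, Finset.sum_apply, Finset.mul_sum]
  rfl
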